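/- Let $\mathcal H,\mathcal G$ be real Hilbert spaces. For a set-valued operator $M$ on a real Hilbert space, $M^{-1}$ is its inverse, $J_M=(\mathrm{Id}+M)^{-1}$ its resolvent; $M$ is $\rho$-strongly monotone if $\langle x-y, u-v\rangle\ge\rho\|x-y\|^2$ for all $u\in Mx$, $v\in My$, it is monotone if this holds with $\rho=0$, and it is $\rho$-cocoercive if $M^{-1}$ is $\rho$-strongly monotone. Put $B\,\square\,D=(B^{-1}+D^{-1})^{-1}$. Let $\alpha_T\in\,]0,1[$ and let $T:\mathcal H\to\mathcal H$ be $\alpha_T$-averaged quasi-nonexpansive: $\operatorname{Fix}T\ne\varnothing$ and $\|Tx-y\|^2\le\|x-y\|^2-\frac{1-\alpha_T}{\alpha_T}\|x-Tx\|^2$ for all $x\in\mathcal H$, $y\in\operatorname{Fix}T$. Let $V$ be a closed subspace of $\mathcal G$ with orthogonal projector $P_V$, and let $L:\mathcal H\to\mathcal G$ be a nonzero bounded linear operator with $\operatorname{ran}L\subset V$. Let $\rho,\chi\ge0$ and $\delta,\beta>0$. Let $A:\mathcal H\to2^{\mathcal H}$ and $D:\mathcal G\to2^{\mathcal G}$ be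 maximally monotone, and $\rho$- and $\delta$-strongly monotone respectively. Let $B:\mathcal G\to2^{\mathcal G}$ be maximally monotone and $\chi$-cocoercive, and let $C:\mathcal H\to\mathcal H$ be $\beta$-cocoercive. A *solution* is a pair $(\hat x,\hat u)$ with $\hat x\in\operatorname{Fix}T$, $\hat u\in V$, $-L^*\hat u\in A\hat x+C\hat x$ and $\hat u\in(B\,\square\,D)(L\hat x)$ (in particular $0\in A\hat x+L^*(B\,\square\,D)(L\hat x)+C\hat x$). Assume that a solution exists. For sequences $(\theta_k),(\gamma_k),(\tau_k)$ of positive numbers and $x^0=\bar x^0\in\mathcal H$, $u^0\in\mathcal G$, consider, for $k\in\mathbb N$, $$\begin{aligned}\eta^{k+1}&=J_{\gamma_kB^{-1}}\big(u^k+\gamma_k(L\bar x^k-D^{-1}u^k)\big),& u^{k+1}&=P_V\eta^{k+1},\\ p^{k+1}&=J_{\tau_kA}\big(x^k-\tau_k(L^*u^{k+1}+Cx^k)\big),& x^{k+1}&=Tp^{k+1},\\ \bar x^{k+1}&=x^{k+1}+\theta_k(p^{k+1}-x^k).\end{aligned}$$ Set $p^0=x^{-1}=x^0$ (so that at $k=0$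 the terms below containing $p^k-x^{k-1}$ vanish, for any values of $\theta_{-1},\eta^0$). Then: (i) Suppose that $\theta_k\in\,]0,1]$, $\gamma_k\in\,]0,2\delta[$ and $\tau_k\in\,]0,2\beta[$ for all $k$, and that $$\|L\|^2\le\Big(\frac1{\tau_0}-\frac1{2\beta}\Big)\Big(\frac1{\gamma_0}-\frac1{2\delta}\Big).\tag{1}$$ Then for every $k\in\mathbb N$ and every solution $(\hat x,\hat u)$, $$\begin{aligned}\frac{\|x^k-\hat x\|^2}{\tau_k}+\frac{\|u^k-\hat u\|^2}{\gamma_k}\ge{}&(2\rho\tau_k+1)\frac{\|p^{k+1}-\hat x\|^2}{\tau_k}+\|p^{k+1}-x^k\|^2\Big(\frac1{\tau_k}-\frac1{2\beta}\Big)\\&+(2\chi\gamma_k+1)\frac{\|\eta^{k+1}-\hat u\|^2}{\gamma_k}+\|\eta^{k+1}-u^k\|^2\Big(\frac1{\gamma_k}-\frac1{2\delta}\Big)\\&+2\langle L(p^{k+1}-x^k),\eta^{k+1}-\hat u\rangle-2\theta_{k-1}\langle L(p^k-x^{k-1}),\eta^k-\hat u\rangle\\&-2\theta_{k-1}\|L\|\,\|p^k-x^{k-1}\|\,\|\eta^{k+1}-u^k\|.\end{aligned}$$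 (ii) Suppose that $\rho=\chi=0$ and that $\mathrm{Id}-T$ is demiclosed at $0$ (if $z^k\rightharpoonup z$ and $z^k-Tz^k\to0$, then $z\in\operatorname{Fix}T$; this holds for instance when $T$ is nonexpansive). If $\theta_k\equiv1$, $\tau_k\equiv\tau\in\,]0,2\beta[$, $\gamma_k\equiv\gamma\in\,]0,2\delta[$ and (1) holds with strict inequality, then $x^k\rightharpoonup\hat x$ and $u^k\rightharpoonup\hat u$ for some solution $(\hat x,\hat u)$. (iii) Suppose that $\rho>0$, $\chi=0$ and $D^{-1}=0$ (that is, $\delta=+\infty$). If $\tau_0\in\,]0,2\beta[$ and $\gamma_0>0$ satisfy $\|L\|^2=\big(\frac1{\tau_0}-\frac1{2\beta}\big)\frac1{\gamma_0}$ and, for all $k$, $\theta_k=1/\sqrt{1+2\rho\tau_k}$, $\tau_{k+1}=\theta_k\tau_k$, $\gamma_{k+1}=\gamma_k/\theta_k$, then for every solution $(\hat x,\hat u)$ and every $\varepsilon>0$ there is $N_0\ge1$ such that, for all $k\ge N_0$, $$\|x^k-\hat x\|^2\le\frac{1+\varepsilon}{k^2}\Big(\frac{\|x^0-\hat x\|^2}{\rho^2\tau_0^2}+\frac{2\beta\|L\|^2}{\rho^2(2\beta-\tau_0)}\|u^0-\hat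 u\|^2\Big).$$ (iv) Suppose that $\rho>0$ and $\chi>0$, and let $$\mu=\frac{2\sqrt{\rho\chi}}{\|L\|},\qquad\alpha=\min\Big\{\frac{\mu\rho}{\rho+\frac\mu{4\beta}},\frac{\mu\chi}{\chi+\frac\mu{4\delta}}\Big\},\qquad \theta\in\,](1+\alpha)^{-1},1],\qquad\omega=\frac{1+\theta}{2+\alpha}.$$ Then $\omega\in[(1+\alpha)^{-1},\theta[$, and if $\theta_k\equiv\theta$, $\tau_k\equiv\frac{2\beta\mu}{\mu+4\beta\rho}$ and $\gamma_k\equiv\frac{2\mu\delta}{\mu+4\delta\chi}$, then for every solution $(\hat x,\hat u)$ and every $k\in\mathbb N$, $$\Big(\chi(1-\omega)+\frac\mu{4\delta}\Big)\|u^k-\hat u\|^2+\Big(\rho+\frac\mu{4\beta}\Big)\|x^k-\hat x\|^2\le\omega^k\Big(\Big(\chi+\frac\mu{4\delta}\Big)\|u^0-\hat u\|^2+\Big(\rho+\frac\mu{4\beta}\Big)\|x^0-\hat x\|^2\Big).$$ -/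

import Mathlib

open Filter Topology
open scoped Pointwise InnerProductSpace

/-! ## Set-valued operators on real Hilbert spaces -/

section SetValued

variable {E : Type*} [NormedAddCommGroup E] [InnerProductSpace ℝ E]

/-- The inverse of a set-valued operator: `x ∈ M⁻¹ u` if and only if `u ∈ M x`. -/
def svInverse (M : E → Set E) : E → Set E := fun u => {x | u ∈ M x}

/-- A single-valued map viewed as a set-valued operator. -/
def svOfFun (C : E → E) : E → Set E := fun x => {C x}

/-- `M` is `ρ`-strongly monotone. -/
def StronglyMonotone (ρ : ℝ) (M : E → Set E) : Prop :=
  ∀ x u y v : E, u ∈ M x → v ∈ M y → ρ * ‖x - y‖ ^ 2 ≤ ⟪x - y, u - v⟫_ℝ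

/-- `M` is `ρ`-cocoercive: its inverse is `ρ`-strongly monotone. -/
def Cocoercive (ρ : ℝ) (M : E → Set E) : Prop :=
  StronglyMonotone ρ (svInverse M)

/-- `M` is monotone, and its graph is maximal for inclusion among the graphs of monotone
operators. -/
def MaximallyMonotone (M : E → Set E) : Prop :=
  StronglyMonotone 0 M ∧
    ∀ N : E → Set E, StronglyMonotone 0 N → (∀ x, M x ⊆ N x) → N = M

/-- The resolvent `(Id + M)⁻¹`. -/
def svResolvent (M : E → Set E) : E → Set E := svInverse (svOfFun id + M)

/-- The parallel sum `(B⁻¹ + D⁻¹)⁻¹`. -/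
def parallelSum (B D : E → Set E) : E → Set E :=
  svInverse (svInverse B + svInverse D)

/-- `T` has a fixed point and is `α`-averaged quasi-nonexpansive. -/
def AveragedQuasiNonexpansive (α : ℝ) (T : E → E) : Prop :=
  (Function.fixedPoints T).Nonempty ∧
    ∀ x : E, ∀ y ∈ Function.fixedPoints T,
      ‖T x - y‖ ^ 2 ≤ ‖x - y‖ ^ 2 - ((1 - α) / α) * ‖x - T x‖ ^ 2

/-- The sequence `z` converges weakly to `w`. -/
def WeaklyConverges (z : ℕ → E) (w : E) : Prop :=
  Tendsto (fun k => toWeakSpace ℝ E (z k)) atTop (𝓝 (toWeakSpace ℝ E w))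

/-- `Id - T` is demiclosed at zero: weak limits of sequences `z` with `z k - T (z k) → 0`
strongly are fixed points of `T`. -/
def DemiclosedAtZero (T : E → E) : Prop :=
  ∀ (z : ℕ → E) (w : E), WeaklyConverges z w →
    Tendsto (fun k => z k - T (z k)) atTop (𝓝 0) → w ∈ Function.fixedPoints T

end SetValued

/-! ## The constrained primal-dual inclusion and the algorithm -/

section Problem

variable {H G : Type*} [NormedAddCommGroup H] [InnerProductSpace ℝ H] [CompleteSpace H]
  [NormedAddCommGroup G] [InnerProductSpace ℝ G] [CompleteSpace G]

/-- `xh` solves the primal inclusion: `xh ∈ Fix T` and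
`0 ∈ A xh + L* (B □ D) (L xh) + C xh`. -/
def SolvesPrimal (T : H → H) (L : H →L[ℝ] G) (A : H → Set H) (B D : G → Set G) (C : H → H)
    (xh : H) : Prop :=
  xh ∈ Function.fixedPoints T ∧
    (0 : H) ∈ A xh + ContinuousLinearMap.adjoint L '' parallelSum B D (L xh) + {C xh}

/-- `(xh, uh)` is a primal-dual solution: `xh ∈ Fix T`, `uh ∈ V`,
`-L* uh ∈ A xh + C xh` and `uh ∈ (B □ D) (L xh)`. -/
def IsPrimalDualSolution (T : H → H) (V : ClosedSubmodule ℝ G) (L : H →L[ℝ] G)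
    (A : H → Set H) (B D : G → Set G) (C : H → H) (xh : H) (uh : G) : Prop :=
  xh ∈ Function.fixedPoints T ∧ uh ∈ V ∧
    -(ContinuousLinearMap.adjoint L uh) ∈ A xh + {C xh} ∧
    uh ∈ parallelSum B D (L xh)

/-- `uh` solves the dual inclusion. -/
def SolvesDual (T : H → H) (V : ClosedSubmodule ℝ G) (L : H →L[ℝ] G)
    (A : H → Set H) (B D : G → Set G) (C : H → H) (uh : G) : Prop :=
  ∃ xh : H, IsPrimalDualSolution T V L A B D C xh uh

/-- The two components of a primal-dual solution solve the primal and the dual inclusion. -/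
theorem IsPrimalDualSolution.solves {T : H → H} {V : ClosedSubmodule ℝ G} {L : H →L[ℝ] G}
    {A : H → Set H} {B D : G → Set G} {C : H → H} {xh : H} {uh : G}
    (h : IsPrimalDualSolution T V L A B D C xh uh) :
    SolvesPrimal T L A B D C xh ∧ SolvesDual T V L A B D C uh := by
  refine ⟨⟨h.1, ?_⟩, xh, h⟩
  obtain ⟨a, ha, c, hc, hac⟩ := h.2.2.1
  refine ⟨a + ContinuousLinearMap.adjoint L uh,
    ⟨a, ha, _, ⟨uh, h.2.2.2, rfl⟩, rfl⟩, c, hc, ?_⟩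
  have hac' : a + c = -(ContinuousLinearMap.adjoint L uh) := hac
  have : a + ContinuousLinearMap.adjoint L uh + c
      = (a + c) + ContinuousLinearMap.adjoint L uh := by abel
  simp [this, hac']

/-- The sequences `x, xbar, p, u, η` are generated by the projected primal-dual splitting
algorithm with parameters `θ, γ, τ`. The values `p (k + 1)` and `η (k + 1)` are produced at
iteration `k`; `p 0 = x 0` is a convention, and `η 0` is arbitrary (neither is used by the
algorithm). The operator `D⁻¹` is single-valued in the situation of interest, and `d` below
is its value at `u k`. -/
structure IsProjectedPrimalDual (T : H → H) (V : ClosedSubmodule ℝ G) (L : H →L[ℝ] G)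
    (A : H → Set H) (B D : G → Set G) (C : H → H) (θ γ τ : ℕ → ℝ)
    (x xbar p : ℕ → H) (u η : ℕ → G) : Prop where
  xbar_zero : xbar 0 = x 0
  p_zero : p 0 = x 0
  dual_step : ∀ k, ∃ d ∈ svInverse D (u k),
    η (k + 1) ∈ svResolvent (γ k • svInverse B) (u k + γ k • (L (xbar k) - d))
  dual_proj : ∀ k, u (k + 1) = V.toSubmodule.starProjection (η (k + 1))
  primal_step : ∀ k, p (k + 1) ∈ svResolvent (τ k • A)
    (x k - τ k • (ContinuousLinearMap.adjoint L (u (k + 1)) + C (x k)))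
  primal_proj : ∀ k, x (k + 1) = T (p (k + 1))
  extrapolation : ∀ k, xbar (k + 1) = x (k + 1) + θ k • (p (k + 1) - x k)

end Problem

/-! ### Maximal monotonicity and weak convergence -/

section Weak

variable {E : Type*} [NormedAddCommGroup E] [InnerProductSpace ℝ E]

/-! Everything rests on one energy inequality. Testing the strong monotonicity of `A` at `p (k + 1)`
and of `B⁻¹` at `η (k + 1)` against a solution gives two forward-backward estimates coupled through
`L`. Since `ran L ⊂ V`, the gap `η - u` is orthogonal to `ran L`, so projecting does not disturb the
coupling. The coupling terms then cancel up to the extrapolation error, which consists of a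
difference of consecutive terms `⟪L (p k - x (k - 1)), η k - uh⟫` (the older one weighted by `θ`)
and a remainder that Cauchy-Schwarz and Young absorb under the step-size condition (`energy_step`,
`energy_le`). Afterwards `T` and `P_V` only decrease distances to the solution.

Weak convergence: keeping the slack of every estimate, including the completed squares of the
cocoercive terms, makes the energy decrease by a sum of squared residuals. All residuals vanish and
the forward terms converge strongly (`tendsto_residuals`). The coupling being skew, monotonicity
passes to weak cluster points, which are therefore solutions, and Opial's lemma gives convergence of
the whole sequence.

Accelerated rate: the choice of `θ` converts the gain `1 + 2ρτ` into a contraction of the energy by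
`θ k`. The factors multiply to `τ k / τ 0`, and `1 / (ρ τ k)` grows like `k`.

Linear rate: scaled by `μ / 2`, the energy contracts by `ω`. The extrapolation weight is split as `θ
= ω + (θ - ω)`, and the strong monotonicity that `ω` leaves over pays for the second part. -/

theorem MaximallyMonotone.mem_of_forall {M : E → Set E} (hM : MaximallyMonotone M) {x u : E}
    (h : ∀ y v, v ∈ M y → 0 ≤ ⟪x - y, u - v⟫_ℝ) : u ∈ M x := by
  -- Adjoining the pair `(x, u)` to the graph keeps it monotone, so by maximality the pair was
  -- already there.
  have hN : StronglyMonotone 0 (fun y => M y ∪ {v | y = x ∧ v = u}) := by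
    rintro y v z w (hv | ⟨rfl, rfl⟩) (hw | ⟨rfl, rfl⟩)
    · exact hM.1 y v z w hv hw
    · have := h y v hv
      rw [← neg_sub y z, ← neg_sub v w, inner_neg_neg] at this
      simpa using this
    · simpa using h z w hw
    · simp
  have := congrFun (hM.2 _ hN fun _ => Set.subset_union_left) x
  rw [← this]
  exact Or.inr ⟨rfl, rfl⟩

/-- The product of a maximally monotone operator and the inverse of another one is maximally
monotone. -/
theorem MaximallyMonotone.mem_prod_of_forall {F : Type*} [NormedAddCommGroup F]
    [InnerProductSpace ℝ F] {M : E → Set E} {N : F → Set F}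
    (hM : MaximallyMonotone M) (hN : MaximallyMonotone N) {x a : E} {u b : F}
    (h : ∀ y a' v b', a' ∈ M y → v ∈ N b' →
      0 ≤ ⟪x - y, a - a'⟫_ℝ + ⟪u - v, b - b'⟫_ℝ) : a ∈ M x ∧ u ∈ N b := by
  have ha : a ∈ M x := by
    -- A pair in the graph of `M` with negative pairing would force `(b, u)` into the graph of `N`;
    -- testing with `(b, u)` itself then contradicts that sign.
    by_contra hcon
    obtain ⟨y, a', ha', hlt⟩ : ∃ y a', a' ∈ M y ∧ ⟪x - y, a - a'⟫_ℝ < 0 := by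
      by_contra! hne
      exact hcon (hM.mem_of_forall hne)
    have hu : u ∈ N b := hN.mem_of_forall fun b' v hv => by
      rw [real_inner_comm]
      linarith [h y a' v b' ha' hv]
    exact absurd (h y a' u b ha' hu) (not_le.2 (by simpa using hlt))
  refine ⟨ha, hN.mem_of_forall fun b' v hv => ?_⟩
  rw [real_inner_comm]
  simpa using h x a v b' ha hv

theorem Filter.Tendsto.inner_of_bounded {z : ℕ → E} {y : ℕ → E} {R : ℝ} (hR : ∀ n, ‖z n‖ ≤ R)
    (hy : Tendsto y atTop (𝓝 0)) : Tendsto (fun n => ⟪z n, y n⟫_ℝ) atTop (𝓝 0) := by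
  refine squeeze_zero_norm (fun n => (norm_inner_le_norm (𝕜 := ℝ) (z n) (y n)).trans
    (mul_le_mul_of_nonneg_right (hR n) (norm_nonneg _))) ?_
  simpa using (tendsto_norm_zero.comp hy).const_mul R

theorem WeaklyConverges.comp {z : ℕ → E} {w : E} (h : WeaklyConverges z w) {φ : ℕ → ℕ}
    (hφ : Tendsto φ atTop atTop) : WeaklyConverges (z ∘ φ) w :=
  Tendsto.comp (f := φ) (g := fun k => toWeakSpace ℝ E (z k)) h hφ

variable [CompleteSpace E]

theorem weaklyConverges_iff {z : ℕ → E} {w : E} :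
    WeaklyConverges z w ↔ ∀ v, Tendsto (fun k => ⟪v, z k⟫_ℝ) atTop (𝓝 ⟪v, w⟫_ℝ) := by
  have hinj : Function.Injective (topDualPairing ℝ E).flip := by
    intro x y hxy
    refine ext_inner_left ℝ fun v => ?_
    exact congrArg (fun f => f (InnerProductSpace.toDual ℝ E v)) hxy
  refine (WeakBilin.tendsto_iff_forall_eval_tendsto _ hinj).trans ⟨fun h v => ?_, fun h f => ?_⟩
  · exact h (InnerProductSpace.toDual ℝ E v)
  · have := h ((InnerProductSpace.toDual ℝ E).symm f)
    simp only [InnerProductSpace.toDual_symm_apply] at this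
    exact this

theorem WeaklyConverges.of_sub_tendsto_zero {z y : ℕ → E} {w : E} (h : WeaklyConverges z w)
    (hzy : Tendsto (fun n => y n - z n) atTop (𝓝 0)) : WeaklyConverges y w := by
  rw [weaklyConverges_iff] at h ⊢
  intro v
  have h2 := (h v).add (Filter.Tendsto.inner_of_bounded (z := fun _ => v) (fun _ => le_rfl) hzy)
  simpa [← inner_add_right] using h2

/-- Uniform boundedness principle for the functionals `⟪z n, ·⟫`. -/
theorem WeaklyConverges.exists_norm_le {z : ℕ → E} {w : E} (h : WeaklyConverges z w) :
    ∃ R, ∀ n, ‖z n‖ ≤ R := by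
  obtain ⟨R, hR⟩ := banach_steinhaus (g := fun n => InnerProductSpace.toDual ℝ E (z n))
    fun v => by
      obtain ⟨R, hR⟩ := (weaklyConverges_iff.1 h v).norm.bddAbove_range
      refine ⟨R, fun n => ?_⟩
      rw [InnerProductSpace.toDual_apply_apply, real_inner_comm]
      exact hR ⟨n, rfl⟩
  exact ⟨R, fun n => by simpa using hR n⟩

theorem WeaklyConverges.sub_const {z : ℕ → E} {w : E} (h : WeaklyConverges z w) (y : E) :
    WeaklyConverges (fun n => z n - y) (w - y) := by
  rw [weaklyConverges_iff] at h ⊢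
  intro v
  simpa [inner_sub_right] using (h v).sub_const ⟪v, y⟫_ℝ

/-- Weak-strong continuity of the inner product. -/
theorem WeaklyConverges.inner {z y : ℕ → E} {w v : E} (h : WeaklyConverges z w)
    (hy : Tendsto y atTop (𝓝 v)) :
    Tendsto (fun n => ⟪z n, y n⟫_ℝ) atTop (𝓝 ⟪w, v⟫_ℝ) := by
  obtain ⟨R, hR⟩ := h.exists_norm_le
  have h1 := weaklyConverges_iff.1 h v
  have h2 : Tendsto (fun n => y n - v) atTop (𝓝 0) := by simpa using hy.sub_const v
  have h3 := h1.add (Filter.Tendsto.inner_of_bounded hR h2)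
  simp_rw [real_inner_comm _ v] at h3
  simpa [← inner_add_right] using h3

/-- The space need not be separable, but the closed span `S` of the sequence is, so sequential
Banach-Alaoglu applies in `S`. Test vectors outside `S` are replaced by their projections. -/
theorem exists_weaklyConverges_subseq {z : ℕ → E} {R : ℝ} (hR : ∀ n, ‖z n‖ ≤ R) :
    ∃ w, ∃ φ : ℕ → ℕ, StrictMono φ ∧ WeaklyConverges (z ∘ φ) w := by
  let S : Submodule ℝ E := (Submodule.span ℝ (Set.range z)).topologicalClosure
  have hS : IsClosed (S : Set E) := Submodule.isClosed_topologicalClosure _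
  have : CompleteSpace S := hS.completeSpace_coe
  have hsep : TopologicalSpace.IsSeparable (S : Set E) :=
    ((Set.countable_range z).isSeparable.span (R := ℝ)).closure
  have : TopologicalSpace.SeparableSpace S := hsep.separableSpace
  have hz : ∀ n, z n ∈ S := fun n =>
    Submodule.le_topologicalClosure _ (Submodule.subset_span ⟨n, rfl⟩)
  let f : ℕ → WeakDual ℝ S := fun n =>
    StrongDual.toWeakDual (InnerProductSpace.toDual ℝ S ⟨z n, hz n⟩)
  obtain ⟨g, -, φ, hφ, hg⟩ := WeakDual.isSeqCompact_closedBall ℝ S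
    (0 : StrongDual ℝ S) R (x := f) (fun n => by simpa [f] using hR n)
  refine ⟨(InnerProductSpace.toDual ℝ S).symm (WeakDual.toStrongDual g), φ, hφ, ?_⟩
  rw [weaklyConverges_iff]
  intro v
  have h1 := ((WeakDual.eval_continuous (S.orthogonalProjectionOnto v)).tendsto g).comp hg
  have key : ∀ s : S, ⟪v, (s : E)⟫_ℝ = ⟪s, S.orthogonalProjectionOnto v⟫_ℝ := by
    intro s
    rw [real_inner_comm]
    exact (Submodule.inner_orthogonalProjectionOnto_eq_of_mem_left s v).symm
  rw [key, InnerProductSpace.toDual_symm_apply]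
  refine h1.congr fun n => ?_
  exact (key ⟨z (φ n), hz _⟩).symm

end Weak

/-! ### Opial's lemma in a weighted product space -/

section Opial

variable {H G : Type*} [NormedAddCommGroup H] [InnerProductSpace ℝ H] [CompleteSpace H]
  [NormedAddCommGroup G] [InnerProductSpace ℝ G] [CompleteSpace G]

theorem exists_weaklyConverges_subseq_pair {x : ℕ → H} {u : ℕ → G} {R R' : ℝ}
    (hx : ∀ n, ‖x n‖ ≤ R) (hu : ∀ n, ‖u n‖ ≤ R') :
    ∃ (w : H) (w' : G) (φ : ℕ → ℕ), StrictMono φ ∧ WeaklyConverges (x ∘ φ) w ∧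
      WeaklyConverges (u ∘ φ) w' := by
  obtain ⟨w, φ, hφ, hw⟩ := exists_weaklyConverges_subseq hx
  obtain ⟨w', ψ, hψ, hw'⟩ := exists_weaklyConverges_subseq (z := u ∘ φ) fun n => hu (φ n)
  exact ⟨w, w', φ ∘ ψ, hφ.comp hψ, hw.comp hψ.tendsto_atTop, hw'⟩

/-- Opial's lemma for pairs, in the norm with weights `1 / τ` and `1 / γ`. -/
theorem opial_pair {x : ℕ → H} {u : ℕ → G} {τ γ : ℝ} (hτ : 0 < τ) (hγ : 0 < γ)
    {S : H → G → Prop} (hS : ∃ z z', S z z')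
    (hlim : ∀ z z', S z z' →
      ∃ l, Tendsto (fun k => ‖x k - z‖ ^ 2 / τ + ‖u k - z'‖ ^ 2 / γ) atTop (𝓝 l))
    (hcl : ∀ (φ : ℕ → ℕ) (w : H) (w' : G), Tendsto φ atTop atTop →
      WeaklyConverges (x ∘ φ) w → WeaklyConverges (u ∘ φ) w' → S w w') :
    ∃ w w', S w w' ∧ WeaklyConverges x w ∧ WeaklyConverges u w' := by
  obtain ⟨R, R', hx, hu⟩ : ∃ R R', (∀ n, ‖x n‖ ≤ R) ∧ ∀ n, ‖u n‖ ≤ R' := by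
    obtain ⟨z, z', hz⟩ := hS
    obtain ⟨l, hl⟩ := hlim z z' hz
    obtain ⟨M, hM⟩ := hl.bddAbove_range
    have hM' : ∀ n, ‖x n - z‖ ^ 2 / τ + ‖u n - z'‖ ^ 2 / γ ≤ M := fun n => hM ⟨n, rfl⟩
    refine ⟨Real.sqrt (M * τ) + ‖z‖, Real.sqrt (M * γ) + ‖z'‖, fun n => ?_, fun n => ?_⟩
    · have h1 : ‖x n - z‖ ^ 2 / τ ≤ M := by
        have : 0 ≤ ‖u n - z'‖ ^ 2 / γ := by positivity
        linarith [hM' n]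
      rw [div_le_iff₀ hτ] at h1
      linarith [Real.le_sqrt_of_sq_le h1, norm_le_norm_sub_add (x n) z]
    · have h1 : ‖u n - z'‖ ^ 2 / γ ≤ M := by
        have : 0 ≤ ‖x n - z‖ ^ 2 / τ := by positivity
        linarith [hM' n]
      rw [div_le_iff₀ hγ] at h1
      linarith [Real.le_sqrt_of_sq_le h1, norm_le_norm_sub_add (u n) z']
  have huniq : ∀ (φ ψ : ℕ → ℕ) (z w : H) (z' w' : G), Tendsto φ atTop atTop →
      Tendsto ψ atTop atTop → WeaklyConverges (x ∘ φ) z → WeaklyConverges (u ∘ φ) z' →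
      WeaklyConverges (x ∘ ψ) w → WeaklyConverges (u ∘ ψ) w' → z = w ∧ z' = w' := by
    intro φ ψ z w z' w' hφ hψ hz hz' hw hw'
    obtain ⟨l, hl⟩ := hlim z z' (hcl φ z z' hφ hz hz')
    obtain ⟨m, hm⟩ := hlim w w' (hcl ψ w w' hψ hw hw')
    -- The quadratic terms cancel in the difference of squared distances to two cluster points, so a
    -- linear functional of the iterates converges along the whole sequence. Its limits along `φ`
    -- and `ψ` must agree, which says that the two points are at distance zero.
    have hq : Tendsto (fun k => ⟪z - w, x k⟫_ℝ / τ + ⟪z' - w', u k⟫_ℝ / γ) atTop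
        (𝓝 (((‖z‖ ^ 2 - ‖w‖ ^ 2) / τ + (‖z'‖ ^ 2 - ‖w'‖ ^ 2) / γ - (l - m)) / 2)) := by
      refine (((hl.sub hm).const_sub _).div_const 2).congr fun k => ?_
      rw [norm_sub_sq_real, norm_sub_sq_real, norm_sub_sq_real, norm_sub_sq_real,
        inner_sub_left, inner_sub_left, real_inner_comm z, real_inner_comm w,
        real_inner_comm z', real_inner_comm w']
      ring
    have h1 := ((weaklyConverges_iff.1 hz (z - w)).div_const τ).add
      ((weaklyConverges_iff.1 hz' (z' - w')).div_const γ)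
    have h2 := ((weaklyConverges_iff.1 hw (z - w)).div_const τ).add
      ((weaklyConverges_iff.1 hw' (z' - w')).div_const γ)
    have e := (tendsto_nhds_unique h1 (hq.comp hφ)).trans
      (tendsto_nhds_unique h2 (hq.comp hψ)).symm
    have e2 : ‖z - w‖ ^ 2 / τ + ‖z' - w'‖ ^ 2 / γ = 0 := by
      rw [← real_inner_self_eq_norm_sq, ← real_inner_self_eq_norm_sq, inner_sub_right,
        inner_sub_right, sub_div, sub_div]
      linarith
    have h3 : 0 ≤ ‖z - w‖ ^ 2 / τ := by positivity
    have h4 : 0 ≤ ‖z' - w'‖ ^ 2 / γ := by positivity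
    have h5 : ‖z - w‖ ^ 2 / τ = 0 := by linarith
    have h6 : ‖z' - w'‖ ^ 2 / γ = 0 := by linarith
    simp only [div_eq_zero_iff, hτ.ne', hγ.ne', or_false, pow_eq_zero_iff two_ne_zero,
      norm_eq_zero, sub_eq_zero] at h5 h6
    exact ⟨h5, h6⟩
  obtain ⟨w, w', φ, hφ, hw, hw'⟩ := exists_weaklyConverges_subseq_pair hx hu
  refine ⟨w, w', hcl φ w w' hφ.tendsto_atTop hw hw', ?_, ?_⟩
  · refine tendsto_of_subseq_tendsto fun ns hns => ?_
    obtain ⟨z, z', ψ, hψ, hz, hz'⟩ := exists_weaklyConverges_subseq_pair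
      (x := x ∘ ns) (u := u ∘ ns) (fun n => hx (ns n)) fun n => hu (ns n)
    obtain ⟨rfl, rfl⟩ := huniq (ns ∘ ψ) φ z w z' w' (hns.comp hψ.tendsto_atTop)
      hφ.tendsto_atTop hz hz' hw hw'
    exact ⟨ψ, hz⟩
  · refine tendsto_of_subseq_tendsto fun ns hns => ?_
    obtain ⟨z, z', ψ, hψ, hz, hz'⟩ := exists_weaklyConverges_subseq_pair
      (x := x ∘ ns) (u := u ∘ ns) (fun n => hx (ns n)) fun n => hu (ns n)
    obtain ⟨rfl, rfl⟩ := huniq (ns ∘ ψ) φ z w z' w' (hns.comp hψ.tendsto_atTop)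
      hφ.tendsto_atTop hz hz' hw hw'
    exact ⟨ψ, hz'⟩

end Opial

/-! ### One forward-backward step -/

section Step

variable {E : Type*} [NormedAddCommGroup E] [InnerProductSpace ℝ E]

theorem mem_of_mem_svResolvent_smul {M : E → Set E} {t : ℝ} (ht : 0 < t) {p q : E}
    (h : p ∈ svResolvent (t • M) q) : t⁻¹ • (q - p) ∈ M p := by
  obtain ⟨p', hp', w, ⟨a, ha, rfl⟩, hq⟩ := h
  obtain rfl : p' = p := hp'
  have : q - p' = t • a := by
    rw [← hq]
    exact add_sub_cancel_left _ _
  rwa [this, smul_smul, inv_mul_cancel₀ ht.ne', one_smul]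

/-- The completed square behind the estimate of a cocoercive forward term. -/
theorem cocoercive_forward_bound {β : ℝ} (hβ : 0 < β) {e w v : E}
    (h : β * ‖e‖ ^ 2 ≤ ⟪e, w⟫_ℝ) :
    -2 * ⟪e, v + w⟫_ℝ + 2 * β * ‖e + (1 / (2 * β)) • v‖ ^ 2 ≤ 1 / (2 * β) * ‖v‖ ^ 2 := by
  rw [norm_add_sq_real, inner_add_right, norm_smul, inner_smul_right, mul_pow, Real.norm_eq_abs,
    sq_abs]
  have : 2 * β * (‖e‖ ^ 2 + 2 * (1 / (2 * β) * ⟪e, v⟫_ℝ) + (1 / (2 * β)) ^ 2 * ‖v‖ ^ 2)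
      = 2 * (β * ‖e‖ ^ 2) + 2 * ⟪e, v⟫_ℝ + 1 / (2 * β) * ‖v‖ ^ 2 := by
    field_simp
  rw [this]
  linarith

theorem two_inner_sub_sub (z q w : E) :
    2 * ⟪q - w, z - q⟫_ℝ = ‖z - w‖ ^ 2 - ‖q - w‖ ^ 2 - ‖q - z‖ ^ 2 := by
  have : z - w = (q - w) + (z - q) := by abel
  rw [this, norm_add_sq_real, norm_sub_rev q z]
  ring

/-- The estimate for one forward-backward step from `z` to `q`, with an additional drift `y`. -/
theorem forward_backward_step {t σ κ s : ℝ} (ht : 0 < t) {z q w y y' d d' : E}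
    (hmono : σ * ‖q - w‖ ^ 2 ≤ ⟪q - w, (t⁻¹ • (z - q) + y - d) - (y' - d')⟫_ℝ)
    (hd : -2 * ⟪d - d', q - w⟫_ℝ + s ≤ κ * ‖q - z‖ ^ 2) :
    (2 * σ * t + 1) * (‖q - w‖ ^ 2 / t) + ‖q - z‖ ^ 2 * (1 / t - κ)
      - 2 * ⟪y - y', q - w⟫_ℝ + s ≤ ‖z - w‖ ^ 2 / t := by
  have h1 : (t⁻¹ • (z - q) + y - d) - (y' - d') = t⁻¹ • (z - q) + (y - y') - (d - d') := by abel
  rw [h1, inner_sub_right, inner_add_right, inner_smul_right, real_inner_comm (y - y'),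
    real_inner_comm (d - d')] at hmono
  have h2 := two_inner_sub_sub z q w
  have h3 : ‖z - w‖ ^ 2 / t = t⁻¹ * (2 * ⟪q - w, z - q⟫_ℝ) + ‖q - w‖ ^ 2 / t + ‖q - z‖ ^ 2 / t := by
    rw [h2]; field_simp; ring
  have h4 : (2 * σ * t + 1) * (‖q - w‖ ^ 2 / t) = 2 * σ * ‖q - w‖ ^ 2 + ‖q - w‖ ^ 2 / t := by
    field_simp
  rw [h3, h4, mul_sub, mul_one_div]
  linarith

theorem Cocoercive.map_le {C : E → E} {β : ℝ} (hC : Cocoercive β (svOfFun C)) (y z : E) :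
    β * ‖C y - C z‖ ^ 2 ≤ ⟪C y - C z, y - z⟫_ℝ :=
  hC (C y) y (C z) z rfl rfl

theorem Cocoercive.forward_bound {C : E → E} {β : ℝ} (hβ : 0 < β) (hC : Cocoercive β (svOfFun C))
    (y z w : E) :
    -2 * ⟪C y - C w, z - w⟫_ℝ + 2 * β * ‖(C y - C w) + (1 / (2 * β)) • (z - y)‖ ^ 2
      ≤ 1 / (2 * β) * ‖z - y‖ ^ 2 := by
  simpa using cocoercive_forward_bound hβ (v := z - y) (hC.map_le y w)

theorem StronglyMonotone.forward_bound {D : E → Set E} {δ : ℝ} (hδ : 0 < δ) (hD : StronglyMonotone δ D)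
    (y w z d e : E) (hd : d ∈ svInverse D y) (he : e ∈ svInverse D w) :
    -2 * ⟪d - e, z - w⟫_ℝ + 2 * δ * ‖(d - e) + (1 / (2 * δ)) • (z - y)‖ ^ 2
      ≤ 1 / (2 * δ) * ‖z - y‖ ^ 2 := by
  simpa using cocoercive_forward_bound hδ (v := z - y) (hD d y e w hd he)

theorem abs_inner_map_le {F : Type*} [NormedAddCommGroup F]
    [InnerProductSpace ℝ F] (L : E →L[ℝ] F) (y : E) (v : F) : |⟪L y, v⟫_ℝ| ≤ ‖L‖ * ‖y‖ * ‖v‖ :=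
  (abs_real_inner_le_norm _ _).trans
    (mul_le_mul_of_nonneg_right (L.le_opNorm y) (norm_nonneg v))

end Step

/-! ### The iteration and its one-step energy estimate -/

section Algorithm

variable {H G : Type*} [NormedAddCommGroup H] [InnerProductSpace ℝ H] [CompleteSpace H]
  [NormedAddCommGroup G] [InnerProductSpace ℝ G] [CompleteSpace G]
  {T : H → H} {V : ClosedSubmodule ℝ G} {L : H →L[ℝ] G}
  {A : H → Set H} {B D : G → Set G} {C : H → H} {θ γ τ : ℕ → ℝ}
  {x xbar p : ℕ → H} {u η : ℕ → G}

/-- Splits `L xh` into the part `dh` taken by `D⁻¹` and the rest taken by `B⁻¹`, the form in which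
monotonicity is tested. -/
theorem IsPrimalDualSolution.exists_dual {xh : H} {uh : G}
    (h : IsPrimalDualSolution T V L A B D C xh uh) :
    xh ∈ Function.fixedPoints T ∧ uh ∈ V ∧
      -(ContinuousLinearMap.adjoint L uh) - C xh ∈ A xh ∧
      ∃ dh ∈ svInverse D uh, L xh - dh ∈ svInverse B uh := by
  obtain ⟨h1, h2, ⟨a, ha, c, hc, hac⟩, b, hb, dh, hdh, hbd⟩ := h
  refine ⟨h1, h2, ?_, dh, hdh, ?_⟩
  · obtain rfl : c = C xh := hc
    have hac' : a + C xh = _ := hac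
    rwa [← hac', add_sub_cancel_right]
  · have hbd' : b + dh = L xh := hbd
    rwa [← hbd', add_sub_cancel_right]

theorem inner_starProjection_sub_eq_zero {y z : G} (hy : y ∈ V) :
    ⟪y, z - V.toSubmodule.starProjection z⟫_ℝ = 0 :=
  (Submodule.sub_starProjection_mem_orthogonal z) y hy

theorem norm_starProjection_sub_sq {y z : G} (hy : y ∈ V) :
    ‖V.toSubmodule.starProjection z - y‖ ^ 2 + ‖z - V.toSubmodule.starProjection z‖ ^ 2
      = ‖z - y‖ ^ 2 := by
  have hm : V.toSubmodule.starProjection z - y ∈ V :=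
    V.toSubmodule.sub_mem (Submodule.starProjection_apply_mem _ _) hy
  have h := inner_starProjection_sub_eq_zero (z := z) hm
  have h2 : z - y = (V.toSubmodule.starProjection z - y)
    + (z - V.toSubmodule.starProjection z) := by abel
  rw [h2, norm_add_sq_real, h]
  ring

namespace IsProjectedPrimalDual

theorem exists_dual
    (h : IsProjectedPrimalDual T V L A B D C θ γ τ x xbar p u η) (hγ : ∀ k, 0 < γ k) :
    ∃ d : ℕ → G, ∀ k, d k ∈ svInverse D (u k) ∧
      (γ k)⁻¹ • (u k - η (k + 1)) + L (xbar k) - d k ∈ svInverse B (η (k + 1)) := by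
  choose d hd hη using h.dual_step
  refine ⟨d, fun k => ⟨hd k, ?_⟩⟩
  have := mem_of_mem_svResolvent_smul (hγ k) (hη k)
  convert this using 1
  rw [add_sub_right_comm (u k), smul_add, smul_smul, inv_mul_cancel₀ (hγ k).ne', one_smul]
  abel

theorem primal_mem
    (h : IsProjectedPrimalDual T V L A B D C θ γ τ x xbar p u η) (hτ : ∀ k, 0 < τ k) (k : ℕ) :
    (τ k)⁻¹ • (x k - p (k + 1)) + -(ContinuousLinearMap.adjoint L (u (k + 1))) - C (x k)
      ∈ A (p (k + 1)) := by
  have := mem_of_mem_svResolvent_smul (hτ k) (h.primal_step k)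
  convert this using 1
  rw [sub_right_comm (x k), smul_sub _ (x k - p (k + 1)), smul_smul, inv_mul_cancel₀ (hτ k).ne', one_smul]
  abel

/-- Uniform in `k`: for `k = 0` truncated subtraction gives `x (0 - 1) = x 0 = p 0`, so the
extrapolation term vanishes. -/
theorem xbar_eq
    (h : IsProjectedPrimalDual T V L A B D C θ γ τ x xbar p u η) (k : ℕ) : xbar k = x k + θ (k - 1) • (p k - x (k - 1)) := by
  cases k with
  | zero => simp [h.xbar_zero, h.p_zero]
  | succ k => exact h.extrapolation k

/-- The projection residual is orthogonal to `V`, which contains `ran L`. This allows `u` and `η` to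
be exchanged in every coupling term. -/
theorem inner_dual_gap
    (h : IsProjectedPrimalDual T V L A B D C θ γ τ x xbar p u η) (hLV : ∀ z : H, L z ∈ V) (z : H) (k : ℕ) :
    ⟪L z, η (k + 1) - u (k + 1)⟫_ℝ = 0 := by
  rw [h.dual_proj]
  exact inner_starProjection_sub_eq_zero (hLV z)

/-- For `k = 0` the arbitrary `η 0` has no relation to `u 0`, but the first factor is zero. -/
theorem inner_increment_dual_gap
    (h : IsProjectedPrimalDual T V L A B D C θ γ τ x xbar p u η) (hLV : ∀ z : H, L z ∈ V) (k : ℕ) (v : G) :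
    ⟪L (p k - x (k - 1)), η k - v⟫_ℝ = ⟪L (p k - x (k - 1)), u k - v⟫_ℝ := by
  cases k with
  | zero => simp [h.p_zero]
  | succ k =>
    rw [← sub_add_sub_cancel (η (k + 1)) (u (k + 1)) v, inner_add_right,
      h.inner_dual_gap hLV, zero_add]

theorem norm_dual_sub_sq
    (h : IsProjectedPrimalDual T V L A B D C θ γ τ x xbar p u η) {uh : G} (huh : uh ∈ V) (k : ℕ) :
    ‖u (k + 1) - uh‖ ^ 2 + ‖η (k + 1) - u (k + 1)‖ ^ 2 = ‖η (k + 1) - uh‖ ^ 2 := by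
  rw [h.dual_proj]
  exact norm_starProjection_sub_sq huh

theorem norm_dual_sub_sq_le
    (h : IsProjectedPrimalDual T V L A B D C θ γ τ x xbar p u η) {uh : G} (huh : uh ∈ V) (k : ℕ) :
    ‖u (k + 1) - uh‖ ^ 2 ≤ ‖η (k + 1) - uh‖ ^ 2 := by
  nlinarith [h.norm_dual_sub_sq huh k, sq_nonneg ‖η (k + 1) - u (k + 1)‖]

theorem norm_primal_sub_sq_le
    (h : IsProjectedPrimalDual T V L A B D C θ γ τ x xbar p u η) {α : ℝ} (hT : AveragedQuasiNonexpansive α T)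
    (hα : α ∈ Set.Ioo (0 : ℝ) 1) {xh : H} (hxh : xh ∈ Function.fixedPoints T) (k : ℕ) :
    ‖x (k + 1) - xh‖ ^ 2 ≤ ‖p (k + 1) - xh‖ ^ 2 := by
  rw [h.primal_proj]
  have h0 : 0 ≤ (1 - α) / α := div_nonneg (by linarith [hα.2]) hα.1.le
  nlinarith [hT.2 (p (k + 1)) xh hxh, mul_nonneg h0 (sq_nonneg ‖p (k + 1) - T (p (k + 1))‖)]

/-- The one-step energy estimate; `s` and `s'` collect the slack of the forward steps. -/
theorem energy_step
    (h : IsProjectedPrimalDual T V L A B D C θ γ τ x xbar p u η) {ρ χ κ κ' s s' : ℝ} (hLV : ∀ z : H, L z ∈ V) (hAρ : StronglyMonotone ρ A)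
    (hBχ : Cocoercive χ B) {k : ℕ} (hγ : ∀ k, 0 < γ k) (hτ : ∀ k, 0 < τ k) {xh : H} {uh d dh : G}
    (hxh : -(ContinuousLinearMap.adjoint L uh) - C xh ∈ A xh)
    (hdh : L xh - dh ∈ svInverse B uh)
    (hd : (γ k)⁻¹ • (u k - η (k + 1)) + L (xbar k) - d ∈ svInverse B (η (k + 1)))
    (hC : -2 * ⟪C (x k) - C xh, p (k + 1) - xh⟫_ℝ + s ≤ κ * ‖p (k + 1) - x k‖ ^ 2)
    (hD : -2 * ⟪d - dh, η (k + 1) - uh⟫_ℝ + s' ≤ κ' * ‖η (k + 1) - u k‖ ^ 2) :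
    (2 * ρ * τ k + 1) * (‖p (k + 1) - xh‖ ^ 2 / τ k)
      + ‖p (k + 1) - x k‖ ^ 2 * (1 / τ k - κ)
      + (2 * χ * γ k + 1) * (‖η (k + 1) - uh‖ ^ 2 / γ k)
      + ‖η (k + 1) - u k‖ ^ 2 * (1 / γ k - κ')
      + 2 * ⟪L (p (k + 1) - x k), η (k + 1) - uh⟫_ℝ
      - 2 * θ (k - 1) * ⟪L (p k - x (k - 1)), η k - uh⟫_ℝ
      - 2 * θ (k - 1) * ⟪L (p k - x (k - 1)), η (k + 1) - u k⟫_ℝ + s + s'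
      ≤ ‖x k - xh‖ ^ 2 / τ k + ‖u k - uh‖ ^ 2 / γ k := by
  have hP := forward_backward_step (hτ k)
    (hAρ _ _ _ _ (h.primal_mem hτ k) hxh) hC
  have hQ := forward_backward_step (hγ k) (hBχ _ _ _ _ hd hdh) hD
  -- The primal coupling, rewritten with `η` in place of `u`, is the negative of the leading term of
  -- the dual coupling in `e2`. What survives is the extrapolation error, split in `e3` into the
  -- previous cross term and a remainder.
  have e1 : ⟪-(ContinuousLinearMap.adjoint L (u (k + 1))) - -(ContinuousLinearMap.adjoint L uh),
      p (k + 1) - xh⟫_ℝ = -⟪L (p (k + 1) - xh), η (k + 1) - uh⟫_ℝ := by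
    rw [← sub_add_sub_cancel (η (k + 1)) (u (k + 1)) uh, inner_add_right, h.inner_dual_gap hLV,
      zero_add, neg_sub_neg, ← map_sub, ContinuousLinearMap.adjoint_inner_left, real_inner_comm,
      ← neg_sub (u (k + 1)), inner_neg_right]
  have e2 : ⟪L (xbar k) - L xh, η (k + 1) - uh⟫_ℝ
      = ⟪L (p (k + 1) - xh), η (k + 1) - uh⟫_ℝ - ⟪L (p (k + 1) - x k), η (k + 1) - uh⟫_ℝ
        + θ (k - 1) * ⟪L (p k - x (k - 1)), η (k + 1) - uh⟫_ℝ := by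
    rw [h.xbar_eq k, ← inner_sub_left, ← real_inner_smul_left, ← inner_add_left]
    congr 1
    simp only [map_add, map_sub, map_smul]
    abel
  have e3 : ⟪L (p k - x (k - 1)), η (k + 1) - uh⟫_ℝ
      = ⟪L (p k - x (k - 1)), η k - uh⟫_ℝ + ⟪L (p k - x (k - 1)), η (k + 1) - u k⟫_ℝ := by
    rw [h.inner_increment_dual_gap hLV, ← inner_add_right]
    congr 1
    abel
  rw [e1] at hP
  rw [e2, e3] at hQ
  linarith

end IsProjectedPrimalDual

end Algorithm

/-! ### The energy inequality and the accelerated rate -/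

section Rates

variable {H G : Type*} [NormedAddCommGroup H] [InnerProductSpace ℝ H] [CompleteSpace H]
  [NormedAddCommGroup G] [InnerProductSpace ℝ G] [CompleteSpace G]
  {T : H → H} {V : ClosedSubmodule ℝ G} {L : H →L[ℝ] G}
  {A : H → Set H} {B D : G → Set G} {C : H → H} {θ γ τ : ℕ → ℝ}
  {x xbar p : ℕ → H} {u η : ℕ → G}

namespace IsProjectedPrimalDual

/-- The one-step energy inequality, with the constant `κ` in place of `1 / (2δ)`. -/
theorem energy_le {ρ χ β κ : ℝ} (h : IsProjectedPrimalDual T V L A B D C θ γ τ x xbar p u η)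
    (hLV : ∀ z : H, L z ∈ V) (hAρ : StronglyMonotone ρ A)
    (hBχ : Cocoercive χ B) (hβ : 0 < β) (hC : Cocoercive β (svOfFun C))
    (hD : ∀ y w z d e : G, d ∈ svInverse D y → e ∈ svInverse D w →
      -2 * ⟪d - e, z - w⟫_ℝ ≤ κ * ‖z - y‖ ^ 2)
    (hγ : ∀ k, 0 < γ k) (hτ : ∀ k, 0 < τ k) {xh : H} {uh : G}
    (hs : IsPrimalDualSolution T V L A B D C xh uh) (k : ℕ) :
    (2 * ρ * τ k + 1) * (‖p (k + 1) - xh‖ ^ 2 / τ k)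
      + ‖p (k + 1) - x k‖ ^ 2 * (1 / τ k - 1 / (2 * β))
      + (2 * χ * γ k + 1) * (‖η (k + 1) - uh‖ ^ 2 / γ k)
      + ‖η (k + 1) - u k‖ ^ 2 * (1 / γ k - κ)
      + 2 * ⟪L (p (k + 1) - x k), η (k + 1) - uh⟫_ℝ
      - 2 * θ (k - 1) * ⟪L (p k - x (k - 1)), η k - uh⟫_ℝ
      - 2 * θ (k - 1) * ⟪L (p k - x (k - 1)), η (k + 1) - u k⟫_ℝ
      ≤ ‖x k - xh‖ ^ 2 / τ k + ‖u k - uh‖ ^ 2 / γ k := by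
  obtain ⟨-, -, hxh, dh, hdh, hbh⟩ := hs.exists_dual
  obtain ⟨d, hd⟩ := h.exists_dual hγ
  have hCk : -2 * ⟪C (x k) - C xh, p (k + 1) - xh⟫_ℝ + 0
      ≤ 1 / (2 * β) * ‖p (k + 1) - x k‖ ^ 2 := by
    have := hC.forward_bound hβ (x k) (p (k + 1)) xh
    have h0 : 0 ≤ 2 * β * ‖(C (x k) - C xh) + (1 / (2 * β)) • (p (k + 1) - x k)‖ ^ 2 := by
      positivity
    linarith
  have hDk : -2 * ⟪d k - dh, η (k + 1) - uh⟫_ℝ + 0 ≤ κ * ‖η (k + 1) - u k‖ ^ 2 := by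
    rw [add_zero]
    exact hD _ _ _ _ _ (hd k).1 hdh
  have := h.energy_step hLV hAρ hBχ hγ hτ hxh hbh (hd k).2 hCk hDk
  linarith

theorem energy_le_norm {ρ χ β δ : ℝ}
    (h : IsProjectedPrimalDual T V L A B D C θ γ τ x xbar p u η)
    (hLV : ∀ z : H, L z ∈ V) (hAρ : StronglyMonotone ρ A)
    (hBχ : Cocoercive χ B) (hβ : 0 < β) (hC : Cocoercive β (svOfFun C))
    (hδ : 0 < δ) (hD : StronglyMonotone δ D) (hθ : ∀ k, 0 ≤ θ k)
    (hγ : ∀ k, 0 < γ k) (hτ : ∀ k, 0 < τ k) {xh : H} {uh : G}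
    (hs : IsPrimalDualSolution T V L A B D C xh uh) (k : ℕ) :
    ‖x k - xh‖ ^ 2 / τ k + ‖u k - uh‖ ^ 2 / γ k ≥
      (2 * ρ * τ k + 1) * (‖p (k + 1) - xh‖ ^ 2 / τ k)
      + ‖p (k + 1) - x k‖ ^ 2 * (1 / τ k - 1 / (2 * β))
      + (2 * χ * γ k + 1) * (‖η (k + 1) - uh‖ ^ 2 / γ k)
      + ‖η (k + 1) - u k‖ ^ 2 * (1 / γ k - 1 / (2 * δ))
      + 2 * ⟪L (p (k + 1) - x k), η (k + 1) - uh⟫_ℝ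
      - 2 * θ (k - 1) * ⟪L (p k - x (k - 1)), η k - uh⟫_ℝ
      - 2 * θ (k - 1) * ‖L‖ * ‖p k - x (k - 1)‖ * ‖η (k + 1) - u k‖ := by
  have h1 := h.energy_le hLV hAρ hBχ hβ hC (fun y w z d e hd he => by
    have := hD.forward_bound hδ y w z d e hd he
    have h0 : 0 ≤ 2 * δ * ‖(d - e) + (1 / (2 * δ)) • (z - y)‖ ^ 2 := by positivity
    linarith) hγ hτ hs k
  have h2 := mul_le_mul_of_nonneg_left
    ((le_abs_self _).trans (abs_inner_map_le L (p k - x (k - 1)) (η (k + 1) - u k)))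
    (mul_nonneg zero_le_two (hθ (k - 1)))
  linarith

end IsProjectedPrimalDual

/-- The recursion of the accelerated step sizes forces `ρ τ k ~ 1 / k`. -/
theorem accelerated_step_size_bound {ρ : ℝ} (hρ : 0 < ρ) (hτ0 : 0 < τ 0)
    (hτ : ∀ k, τ (k + 1) = 1 / Real.sqrt (1 + 2 * ρ * τ k) * τ k) {ε : ℝ} (hε : 0 < ε) :
    ∃ N₀ : ℕ, 1 ≤ N₀ ∧ ∀ k : ℕ, N₀ ≤ k → τ k ^ 2 ≤ (1 + ε) / (k ^ 2 * ρ ^ 2) := by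
  have hpos : ∀ k, 0 < τ k := by
    intro k
    induction k with
    | zero => exact hτ0
    | succ k ih => rw [hτ]; positivity
  -- For `s = 1 / (ρ τ)` the recursion reads `s (k + 1) ^ 2 = (s k + 1) ^ 2 - 1`, so the increments
  -- of `s` are at most one and tend to one as `s` grows.
  obtain ⟨s, hs⟩ : ∃ s : ℕ → ℝ, ∀ k, s k = 1 / (ρ * τ k) := ⟨_, fun _ => rfl⟩
  have hspos : ∀ k, 0 < s k := fun k => by rw [hs]; have := hpos k; positivity
  have hrec : ∀ k, s (k + 1) ^ 2 = s k ^ 2 + 2 * s k := by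
    intro k
    have h1 : 0 < 1 + 2 * ρ * τ k := by have := hpos k; positivity
    have h2 := hpos k
    rw [hs, hs, hτ, div_pow, mul_pow, mul_pow, div_pow, Real.sq_sqrt h1.le]
    field_simp
  have hle : ∀ k, s (k + 1) ≤ s k + 1 := fun k =>
    le_of_sq_le_sq (by nlinarith [hrec k]) (by linarith [hspos k])
  have hmono : Monotone s := monotone_nat_of_le_succ fun k =>
    le_of_sq_le_sq (by nlinarith [hrec k, hspos k]) (hspos _).le
  -- Divide `(s (k + 1) - s k) * (s (k + 1) + s k) = 2 * s k` by the bound `2 * s k + 1` on the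
  -- second factor.
  have hinc : ∀ k, 1 - 1 / (2 * s k + 1) ≤ s (k + 1) - s k := by
    intro k
    have h0 := hspos k
    have h2 : (s (k + 1) - s k) * (s (k + 1) + s k) = 2 * s k := by nlinarith [hrec k]
    have h3 : 0 ≤ s (k + 1) - s k := sub_nonneg.2 (hmono k.le_succ)
    have h4 : 1 - 1 / (2 * s k + 1) = 2 * s k / (2 * s k + 1) := by field_simp; ring
    rw [h4, div_le_iff₀ (by linarith)]
    nlinarith [hle k]
  have htop : Tendsto s atTop atTop := by
    set c : ℝ := 1 - 1 / (2 * s 0 + 1) with hc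
    have hc0 : 0 < c := by
      have := hspos 0
      rw [hc, sub_pos, div_lt_one (by linarith)]
      linarith
    refine tendsto_atTop_mono (f := fun k : ℕ => (k : ℝ) * c) (fun k => ?_)
      (tendsto_natCast_atTop_atTop.atTop_mul_const hc0)
    induction k with
    | zero => simpa using (hspos 0).le
    | succ k ih =>
      have h1 : 1 / (2 * s k + 1) ≤ 1 / (2 * s 0 + 1) :=
        one_div_le_one_div_of_le (by linarith [hspos 0]) (by linarith [hmono (Nat.zero_le k)])
      have := hinc k
      push_cast
      simp only [hc] at ih ⊢
      linarith
  have hlim : Tendsto (fun k => s (k + 1) - s k) atTop (𝓝 1) := by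
    refine tendsto_of_tendsto_of_tendsto_of_le_of_le
      (g := fun k => 1 - 1 / (2 * s k + 1)) (h := fun _ => 1) ?_ tendsto_const_nhds hinc
      fun k => by linarith [hle k]
    have h1 : Tendsto (fun k => 2 * s k + 1) atTop atTop :=
      tendsto_atTop_add_const_right _ _ (htop.const_mul_atTop two_pos)
    simpa using (tendsto_const_nhds (x := (1 : ℝ))).sub h1.inv_tendsto_atTop
  -- The Cesàro means of the increments are `(s k - s 0) / k`. The threshold `1 / √(1 + ε)` below
  -- their limit becomes `1 / (1 + ε)` after squaring.
  have hces := hlim.cesaro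
  simp_rw [Finset.sum_range_sub] at hces
  have hlt : 1 / Real.sqrt (1 + ε) < 1 := by
    rw [div_lt_one (by positivity), Real.lt_sqrt zero_le_one]
    linarith
  obtain ⟨N, hN⟩ := eventually_atTop.1 (hces.eventually (lt_mem_nhds hlt))
  refine ⟨max N 1, le_max_right _ _, fun k hk => ?_⟩
  have hk1 : (0 : ℝ) < k := by exact_mod_cast (le_max_right N 1).trans hk
  have h1 := hN k ((le_max_left N 1).trans hk)
  have h2 : (k : ℝ) / Real.sqrt (1 + ε) ≤ s k := by
    have : (k : ℝ) * (1 / Real.sqrt (1 + ε)) ≤ k * ((k : ℝ)⁻¹ * (s k - s 0)) :=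
      mul_le_mul_of_nonneg_left h1.le hk1.le
    rw [mul_inv_cancel_left₀ hk1.ne', mul_one_div] at this
    linarith [hspos 0]
  have h3 : k ^ 2 / (1 + ε) ≤ s k ^ 2 := by
    have := pow_le_pow_left₀ (by positivity) h2 2
    rwa [div_pow, Real.sq_sqrt (by positivity)] at this
  have h4 := hpos k
  rw [hs, div_pow, one_pow, mul_pow, div_le_div_iff₀ (by positivity) (by positivity)] at h3
  rw [le_div_iff₀ (by positivity)]
  linarith

namespace IsProjectedPrimalDual

/-- Decay of the energy along the accelerated variant, in terms of the primal step sizes. -/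
theorem accelerated_energy_bound {α ρ β : ℝ} (hα : α ∈ Set.Ioo (0 : ℝ) 1)
    (hT : AveragedQuasiNonexpansive α T)
    (h : IsProjectedPrimalDual T V L A B D C θ γ τ x xbar p u η)
    (hLV : ∀ z : H, L z ∈ V) (hAρ : StronglyMonotone ρ A) (hρ : 0 < ρ)
    (hB : Cocoercive 0 B) (hβ : 0 < β) (hC : Cocoercive β (svOfFun C))
    (hD : ∀ v, svInverse D v = {0}) (hγ0 : 0 < γ 0) (hτ0 : τ 0 ∈ Set.Ioo (0 : ℝ) (2 * β))
    (hLn : ‖L‖ ^ 2 = (1 / τ 0 - 1 / (2 * β)) * (1 / γ 0))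
    (hθ : ∀ k, θ k = 1 / Real.sqrt (1 + 2 * ρ * τ k))
    (hτ : ∀ k, τ (k + 1) = θ k * τ k) (hγ : ∀ k, γ (k + 1) = γ k / θ k) {xh : H} {uh : G}
    (hs : IsPrimalDualSolution T V L A B D C xh uh) (k : ℕ) :
    ‖x k - xh‖ ^ 2 / τ k ≤ τ k / τ 0 * (‖x 0 - xh‖ ^ 2 / τ 0 + ‖u 0 - uh‖ ^ 2 / γ 0) := by
  have hτpos : ∀ k, 0 < τ k := by
    intro k
    induction k with
    | zero => exact hτ0.1
    | succ k ih => rw [hτ, hθ]; positivity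
  have hθpos : ∀ k, 0 < θ k := fun k => by rw [hθ]; have := hτpos k; positivity
  have hθsq : ∀ k, θ k ^ 2 * (1 + 2 * ρ * τ k) = 1 := fun k => by
    have h1 : 0 < 1 + 2 * ρ * τ k := by have := hτpos k; positivity
    rw [hθ, div_pow, Real.sq_sqrt h1.le]
    field_simp
  have hθle : ∀ k, θ k ≤ 1 := fun k => by
    have h1 : 0 ≤ 2 * ρ * τ k := by have := hτpos k; positivity
    have h2 := mul_nonneg (sq_nonneg (θ k)) h1
    exact le_of_sq_le_sq (by linarith [hθsq k]) zero_le_one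
  have hγpos : ∀ k, 0 < γ k := by
    intro k
    induction k with
    | zero => exact hγ0
    | succ k ih => rw [hγ]; exact div_pos ih (hθpos k)
  -- The step sizes move in opposite directions with constant product; as `τ` decreases, the
  -- step-size condition imposed at `0` persists as the inequality `hLγ`.
  have hprod : ∀ k, τ k * γ k = τ 0 * γ 0 := by
    intro k
    induction k with
    | zero => rfl
    | succ k ih => rw [hγ, hτ, ← ih]; have := hθpos k; field_simp
  have hτle : ∀ k, τ k ≤ τ 0 := by
    intro k
    induction k with
    | zero => rfl
    | succ k ih => rw [hτ]; nlinarith [hθle k, hτpos k]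
  have hLγ : ∀ k, γ k * ‖L‖ ^ 2 ≤ 1 / τ k - 1 / (2 * β) := by
    intro k
    have h1 : γ k = τ 0 * γ 0 / τ k := by rw [← hprod k]; have := hτpos k; field_simp
    have h2 : γ k * ‖L‖ ^ 2 = 1 / τ k - τ 0 / τ k * (1 / (2 * β)) := by
      rw [hLn, h1]; have := hτpos k; have := hτpos 0; field_simp
    have h3 : 1 ≤ τ 0 / τ k := by rw [one_le_div (hτpos k)]; exact hτle k
    have h4 : 1 * (1 / (2 * β)) ≤ τ 0 / τ k * (1 / (2 * β)) :=
      mul_le_mul_of_nonneg_right h3 (by positivity)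
    linarith
  -- Young's inequality weighted so that the `v` part costs exactly `1 / γ k`. The relation `θ k / γ
  -- k = 1 / γ (k + 1)` matches the indices, and at `0` the increment vanishes.
  have hcross : ∀ (k : ℕ) (v : ℝ),
      2 * θ (k - 1) * (‖L‖ * ‖p k - x (k - 1)‖ * v) ≤ v ^ 2 / γ k
        + θ (k - 1) * (1 / τ (k - 1) - 1 / (2 * β)) * ‖p k - x (k - 1)‖ ^ 2 := by
    intro k v
    cases k with
    | zero => simp only [Nat.zero_sub, h.p_zero, sub_self, norm_zero]
              have := hγpos 0
              have : 0 ≤ v ^ 2 / γ 0 := by positivity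
              simpa using this
    | succ k =>
      simp only [Nat.add_sub_cancel]
      have h1 := mul_le_mul_of_nonneg_right
        (mul_le_mul_of_nonneg_left (hLγ k) (hθpos k).le) (sq_nonneg ‖p (k + 1) - x k‖)
      have hg := hγpos k
      have ht := hθpos k
      have h2 : v ^ 2 / γ (k + 1) = v ^ 2 * θ k / γ k := by rw [hγ]; field_simp
      have h3 : 0 ≤ θ k / γ k * (v - γ k * ‖L‖ * ‖p (k + 1) - x k‖) ^ 2 := by positivity
      have h4 : θ k / γ k * (v - γ k * ‖L‖ * ‖p (k + 1) - x k‖) ^ 2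
          = v ^ 2 * θ k / γ k - 2 * θ k * (‖L‖ * ‖p (k + 1) - x k‖ * v)
            + θ k * (γ k * ‖L‖ ^ 2) * ‖p (k + 1) - x k‖ ^ 2 := by
        field_simp; ring
      rw [h2]
      linarith
  obtain ⟨F, hF⟩ : ∃ F : ℕ → ℝ, ∀ k, F k = ‖x k - xh‖ ^ 2 / τ k + ‖u k - uh‖ ^ 2 / γ k
      + θ (k - 1) * ((1 / τ (k - 1) - 1 / (2 * β)) * ‖p k - x (k - 1)‖ ^ 2
        + 2 * ⟪L (p k - x (k - 1)), η k - uh⟫_ℝ) := ⟨_, fun _ => rfl⟩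
  have hlower : ∀ k, ‖x k - xh‖ ^ 2 / τ k ≤ F k := by
    intro k
    have h1 := hcross k ‖u k - uh‖
    have h2 := mul_le_mul_of_nonneg_left
      ((neg_le_abs _).trans (abs_inner_map_le L (p k - x (k - 1)) (u k - uh)))
      (mul_nonneg zero_le_two (hθpos (k - 1)).le)
    rw [hF, h.inner_increment_dual_gap hLV]
    linarith
  have hstep : ∀ k, F (k + 1) ≤ θ k * F k := by
    intro k
    -- The value `κ = 0` is `1 / (2δ)` at `δ = ∞`: the dual forward term is zero.
    have h1 := h.energy_le (κ := 0) (χ := 0) hLV hAρ hB hβ hC (fun y w z d e hd he => by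
        rw [hD] at hd he
        obtain rfl : d = 0 := hd
        obtain rfl : e = 0 := he
        simp) hγpos hτpos hs k
    have h2 := mul_le_mul_of_nonneg_left
      ((le_abs_self _).trans (abs_inner_map_le L (p k - x (k - 1)) (η (k + 1) - u k)))
      (mul_nonneg zero_le_two (hθpos (k - 1)).le)
    have h3 := hcross k ‖η (k + 1) - u k‖
    have hxp := h.norm_primal_sub_sq_le hT hα hs.1 k
    have huη := h.norm_dual_sub_sq_le hs.2.1 k
    have ht := hθpos k
    have h4 : ‖x (k + 1) - xh‖ ^ 2 / τ (k + 1)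
        ≤ θ k * ((2 * ρ * τ k + 1) * (‖p (k + 1) - xh‖ ^ 2 / τ k)) := by
      -- The choice of `θ` enters here: one factor `θ k` changes `τ k` into `τ (k + 1)`, and `θ k ^
      -- 2 * (1 + 2ρτ k) = 1` uses up the strong monotonicity gain exactly.
      have e1 : θ k * ((2 * ρ * τ k + 1) * (‖p (k + 1) - xh‖ ^ 2 / τ k))
          = ‖p (k + 1) - xh‖ ^ 2 / τ (k + 1) * (θ k ^ 2 * (1 + 2 * ρ * τ k)) := by
        rw [hτ]; have := hτpos k; field_simp; ring
      rw [e1, hθsq, mul_one]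
      exact div_le_div_of_nonneg_right hxp (hτpos _).le
    have h5 : ‖u (k + 1) - uh‖ ^ 2 / γ (k + 1) ≤ θ k * (‖η (k + 1) - uh‖ ^ 2 / γ k) := by
      have e1 : θ k * (‖η (k + 1) - uh‖ ^ 2 / γ k) = ‖η (k + 1) - uh‖ ^ 2 / γ (k + 1) := by
        rw [hγ]; have := hγpos k; field_simp
      rw [e1]
      exact div_le_div_of_nonneg_right huη (hγpos _).le
    have h6 := mul_le_mul_of_nonneg_left (a := θ k)
      (show (2 * ρ * τ k + 1) * (‖p (k + 1) - xh‖ ^ 2 / τ k) + ‖η (k + 1) - uh‖ ^ 2 / γ k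
        + ((1 / τ k - 1 / (2 * β)) * ‖p (k + 1) - x k‖ ^ 2
        + 2 * ⟪L (p (k + 1) - x k), η (k + 1) - uh⟫_ℝ) ≤ F k by
        rw [hF]
        have e2 : ‖η (k + 1) - u k‖ ^ 2 * (1 / γ k - 0) = ‖η (k + 1) - u k‖ ^ 2 / γ k := by ring
        rw [e2] at h1
        linarith) ht.le
    rw [hF, Nat.add_sub_cancel]
    linarith
  have hF0 : F 0 = ‖x 0 - xh‖ ^ 2 / τ 0 + ‖u 0 - uh‖ ^ 2 / γ 0 := by
    rw [hF]; simp [h.p_zero]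
  have hdecay : ∀ k, F k ≤ τ k / τ 0 * F 0 := by
    intro k
    induction k with
    | zero => rw [div_self hτ0.1.ne', one_mul]
    | succ k ih =>
      refine (hstep k).trans ((mul_le_mul_of_nonneg_left ih (hθpos k).le).trans_eq ?_)
      rw [hτ]; ring
  rw [← hF0]
  exact (hlower k).trans (hdecay k)

theorem accelerated_rate {α ρ β : ℝ} (hα : α ∈ Set.Ioo (0 : ℝ) 1)
    (hT : AveragedQuasiNonexpansive α T)
    (h : IsProjectedPrimalDual T V L A B D C θ γ τ x xbar p u η)
    (hLV : ∀ z : H, L z ∈ V) (hAρ : StronglyMonotone ρ A) (hρ : 0 < ρ)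
    (hB : Cocoercive 0 B) (hβ : 0 < β) (hC : Cocoercive β (svOfFun C))
    (hD : ∀ v, svInverse D v = {0}) (hγ0 : 0 < γ 0) (hτ0 : τ 0 ∈ Set.Ioo (0 : ℝ) (2 * β))
    (hLn : ‖L‖ ^ 2 = (1 / τ 0 - 1 / (2 * β)) * (1 / γ 0))
    (hθ : ∀ k, θ k = 1 / Real.sqrt (1 + 2 * ρ * τ k))
    (hτ : ∀ k, τ (k + 1) = θ k * τ k) (hγ : ∀ k, γ (k + 1) = γ k / θ k) {xh : H} {uh : G}
    (hs : IsPrimalDualSolution T V L A B D C xh uh) {ε : ℝ} (hε : 0 < ε) :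
    ∃ N₀ : ℕ, 1 ≤ N₀ ∧ ∀ k : ℕ, N₀ ≤ k →
      ‖x k - xh‖ ^ 2 ≤ (1 + ε) / (k : ℝ) ^ 2 *
        (‖x 0 - xh‖ ^ 2 / (ρ ^ 2 * τ 0 ^ 2)
          + 2 * β * ‖L‖ ^ 2 / (ρ ^ 2 * (2 * β - τ 0)) * ‖u 0 - uh‖ ^ 2) := by
  have hτrec : ∀ k, τ (k + 1) = 1 / Real.sqrt (1 + 2 * ρ * τ k) * τ k := fun k => by
    rw [hτ, hθ]
  obtain ⟨N, hN1, hN⟩ := accelerated_step_size_bound hρ hτ0.1 hτrec hε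
  refine ⟨N, hN1, fun k hk => ?_⟩
  have hb := h.accelerated_energy_bound hα hT hLV hAρ hρ hB hβ hC hD hγ0 hτ0 hLn hθ hτ hγ hs k
  have hk0 : (0 : ℝ) < k := by exact_mod_cast hN1.trans hk
  have hτk : 0 < τ k := by
    clear hb
    clear hk hk0
    induction k with
    | zero => exact hτ0.1
    | succ k ih => rw [hτrec]; positivity
  have hτ00 := hτ0.1
  have hgap : 0 < 2 * β - τ 0 := sub_pos.2 hτ0.2
  rw [div_le_iff₀ hτk] at hb
  have e1 : τ k / τ 0 * (‖x 0 - xh‖ ^ 2 / τ 0 + ‖u 0 - uh‖ ^ 2 / γ 0) * τ k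
      = τ k ^ 2 * ((‖x 0 - xh‖ ^ 2 / τ 0 + ‖u 0 - uh‖ ^ 2 / γ 0) / τ 0) := by ring
  rw [e1] at hb
  refine hb.trans ((mul_le_mul_of_nonneg_right (hN k hk) (by positivity)).trans_eq ?_)
  -- The step-size equality says that `1 / (τ 0 * γ 0) = 2β‖L‖² / (2β - τ 0)`, the coefficient of
  -- the dual term.
  rw [hLn]
  have hne : 2 * β - τ 0 ≠ 0 := hgap.ne'
  field_simp

end IsProjectedPrimalDual

end Rates

/-! ### Linear convergence -/

section Linear

variable {H G : Type*} [NormedAddCommGroup H] [InnerProductSpace ℝ H] [CompleteSpace H]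
  [NormedAddCommGroup G] [InnerProductSpace ℝ G] [CompleteSpace G]
  {T : H → H} {V : ClosedSubmodule ℝ G} {L : H →L[ℝ] G}
  {A : H → Set H} {B D : G → Set G} {C : H → H}
  {x xbar p : ℕ → H} {u η : ℕ → G}

/-- The quotient is the convex combination of `(1 + a)⁻¹` and `θ` with weights `(1 + a) / (2 + a)`
and `1 / (2 + a)`. -/
theorem relaxed_factor_mem_Ico {a θ : ℝ} (ha : 0 < a) (hθ : θ ∈ Set.Ioc ((1 + a)⁻¹) 1) :
    (1 + θ) / (2 + a) ∈ Set.Ico ((1 + a)⁻¹) θ := by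
  have h1 : 1 < θ * (1 + a) := by
    have := hθ.1
    rwa [inv_lt_iff_one_lt_mul₀ (by positivity)] at this
  constructor
  · rw [inv_eq_one_div, div_le_div_iff₀ (by positivity) (by positivity)]
    linarith
  · rw [div_lt_iff₀ (by positivity)]
    linarith

/-- Young's inequality in the weighted form used for linear convergence. -/
theorem weighted_young {ρ χ ω r v : ℝ} (hρ : 0 ≤ ρ) (hχ : 0 ≤ χ) :
    ω * (2 * Real.sqrt (ρ * χ) * r * v) ≤ ω ^ 2 * (ρ * r ^ 2) + χ * v ^ 2 := by
  have h := sq_nonneg (ω * Real.sqrt ρ * r - Real.sqrt χ * v)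
  have e : (ω * Real.sqrt ρ * r - Real.sqrt χ * v) ^ 2
      = ω ^ 2 * (Real.sqrt ρ ^ 2 * r ^ 2) + Real.sqrt χ ^ 2 * v ^ 2
        - ω * (2 * (Real.sqrt ρ * Real.sqrt χ) * r * v) := by ring
  rw [e, Real.sq_sqrt hρ, Real.sq_sqrt hχ, ← Real.sqrt_mul hρ] at h
  linarith

namespace IsProjectedPrimalDual

theorem linear_rate {α ρ χ δ β μ a θ γ τ ω : ℝ} (hα : α ∈ Set.Ioo (0 : ℝ) 1)
    (hT : AveragedQuasiNonexpansive α T) (hL : L ≠ 0)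
    (h : IsProjectedPrimalDual T V L A B D C (fun _ => θ) (fun _ => γ) (fun _ => τ)
      x xbar p u η)
    (hLV : ∀ z : H, L z ∈ V) (hAρ : StronglyMonotone ρ A) (hρ : 0 < ρ) (hχ : 0 < χ)
    (hBχ : Cocoercive χ B) (hβ : 0 < β) (hC : Cocoercive β (svOfFun C))
    (hδ : 0 < δ) (hD : StronglyMonotone δ D)
    (hμ : μ = 2 * Real.sqrt (ρ * χ) / ‖L‖)
    (ha : a = min (μ * ρ / (ρ + μ / (4 * β))) (μ * χ / (χ + μ / (4 * δ))))
    (hθ : θ ∈ Set.Ioc ((1 + a)⁻¹) 1)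
    (hτ : τ = 2 * β * μ / (μ + 4 * β * ρ)) (hγ : γ = 2 * μ * δ / (μ + 4 * δ * χ))
    (hω : ω = (1 + θ) / (2 + a)) :
    ω ∈ Set.Ico ((1 + a)⁻¹) θ ∧
    ∀ xh uh, IsPrimalDualSolution T V L A B D C xh uh → ∀ k : ℕ,
      (χ * (1 - ω) + μ / (4 * δ)) * ‖u k - uh‖ ^ 2 + (ρ + μ / (4 * β)) * ‖x k - xh‖ ^ 2 ≤
        ω ^ k * ((χ + μ / (4 * δ)) * ‖u 0 - uh‖ ^ 2 + (ρ + μ / (4 * β)) * ‖x 0 - xh‖ ^ 2) := by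
  have hLn : 0 < ‖L‖ := norm_pos_iff.2 hL
  have hμ0 : 0 < μ := by rw [hμ]; positivity
  have ha0 : 0 < a := by rw [ha]; exact lt_min (by positivity) (by positivity)
  have hμL : μ * ‖L‖ = 2 * Real.sqrt (ρ * χ) := by rw [hμ]; field_simp
  have hωmem : ω ∈ Set.Ico ((1 + a)⁻¹) θ := hω ▸ relaxed_factor_mem_Ico ha0 hθ
  refine ⟨hωmem, fun xh uh hs => ?_⟩
  have hω0 : 0 < ω := lt_of_lt_of_le (by positivity) hωmem.1
  have hωθ : 0 ≤ θ - ω := sub_nonneg.2 hωmem.2.le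
  have hω1 : 1 ≤ ω * (1 + a) := by
    have := hωmem.1
    rwa [inv_le_iff_one_le_mul₀ (by positivity)] at this
  -- This identity explains the choice of `ω`: the contraction surplus `ω * (1 + a) - 1` equals the
  -- mismatch `θ - ω` between extrapolation and contraction, which it must pay for.
  have hωa : ω * (1 + a) - 1 = θ - ω := by
    have : ω * (2 + a) = 1 + θ := by rw [hω]; field_simp
    linarith
  have hτ0 : 0 < τ := by rw [hτ]; positivity
  have hγ0 : 0 < γ := by rw [hγ]; positivity
  -- After scaling by `μ / 2` the distances carry the weights `c = μ / (2τ)` and `b = μ / (2γ)`, and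
  -- the residuals `p - x` and `η - u` exactly `ρ` and `χ`. The number `a` is the largest with `a *
  -- c ≤ μ * ρ` and `a * b ≤ μ * χ`.
  obtain ⟨c, hc⟩ : ∃ c, c = ρ + μ / (4 * β) := ⟨_, rfl⟩
  obtain ⟨b, hb⟩ : ∃ b, b = χ + μ / (4 * δ) := ⟨_, rfl⟩
  have hc0 : 0 < c := by rw [hc]; positivity
  have hb0 : χ ≤ b := by rw [hb]; have : 0 < μ / (4 * δ) := by positivity
                         linarith
  have hac : a * c ≤ μ * ρ := by
    have : a ≤ μ * ρ / c := by rw [ha, hc]; exact min_le_left _ _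
    rwa [le_div_iff₀ hc0] at this
  have hab : a * b ≤ μ * χ := by
    have : a ≤ μ * χ / b := by rw [ha, hb]; exact min_le_right _ _
    rwa [le_div_iff₀ (hχ.trans_le hb0)] at this
  have hcτ : μ / 2 * (1 / τ) = c := by rw [hτ, hc]; field_simp; ring
  have hbγ : μ / 2 * (1 / γ) = b := by rw [hγ, hb]; field_simp; ring
  have hcβ : μ / 2 * (1 / (2 * β)) = c - ρ := by rw [hc]; field_simp; ring
  have hbδ : μ / 2 * (1 / (2 * δ)) = b - χ := by rw [hb]; field_simp; ring
  obtain ⟨F, hF⟩ : ∃ F : ℕ → ℝ, ∀ k, F k = c * ‖x k - xh‖ ^ 2 + b * ‖u k - uh‖ ^ 2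
      + ω * (ρ * ‖p k - x (k - 1)‖ ^ 2 + μ * ⟪L (p k - x (k - 1)), η k - uh⟫_ℝ) :=
    ⟨_, fun _ => rfl⟩
  -- The value of `μ` makes `μ‖L‖ = 2√(ρχ)`, so Young's inequality produces the weights `ρ` and `χ`.
  have hcross : ∀ (k : ℕ) (v : G), ω * (μ * |⟪L (p k - x (k - 1)), v⟫_ℝ|)
      ≤ ω ^ 2 * (ρ * ‖p k - x (k - 1)‖ ^ 2) + χ * ‖v‖ ^ 2 := by
    intro k v
    refine le_trans ?_ (weighted_young hρ.le hχ.le)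
    refine mul_le_mul_of_nonneg_left ?_ hω0.le
    rw [← hμL]
    refine (mul_le_mul_of_nonneg_left (abs_inner_map_le L _ v) hμ0.le).trans_eq ?_
    ring
  have hstep : ∀ k, F (k + 1) ≤ ω * F k := by
    intro k
    have h1 := h.energy_le hLV hAρ hBχ hβ hC (fun y w z d e hd he => by
      have := hD.forward_bound hδ y w z d e hd he
      have h0 : 0 ≤ 2 * δ * ‖(d - e) + (1 / (2 * δ)) • (z - y)‖ ^ 2 := by positivity
      linarith) (fun _ => hγ0) (fun _ => hτ0) hs k
    have h2 := mul_le_mul_of_nonneg_left h1 (half_pos hμ0).le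
    have e1 : μ / 2 * (‖x k - xh‖ ^ 2 / τ + ‖u k - uh‖ ^ 2 / γ)
        = c * ‖x k - xh‖ ^ 2 + b * ‖u k - uh‖ ^ 2 := by
      rw [← hcτ, ← hbγ]; ring
    have e2 : ∀ P R Y S I J K : ℝ,
        μ / 2 * ((2 * ρ * τ + 1) * (P / τ) + R * (1 / τ - 1 / (2 * β))
          + (2 * χ * γ + 1) * (Y / γ) + S * (1 / γ - 1 / (2 * δ)) + 2 * I - 2 * θ * J - 2 * θ * K)
        = (μ * ρ + c) * P + ρ * R + (μ * χ + b) * Y + χ * S + μ * I - θ * (μ * J)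
          - θ * (μ * K) := by
      intro P R Y S I J K
      have f1 : (2 * ρ * τ + 1) * (P / τ) = 2 * ρ * P + 1 / τ * P := by field_simp
      have f2 : (2 * χ * γ + 1) * (Y / γ) = 2 * χ * Y + 1 / γ * Y := by field_simp
      rw [f1, f2]
      linear_combination (P + R) * hcτ - R * hcβ + (Y + S) * hbγ - S * hbδ
    rw [e1, e2] at h2
    have hxp := h.norm_primal_sub_sq_le hT hα hs.1 k
    have huη := h.norm_dual_sub_sq_le hs.2.1 k
    have e3 : ⟪L (p k - x (k - 1)), η (k + 1) - uh⟫_ℝ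
        = ⟪L (p k - x (k - 1)), η k - uh⟫_ℝ + ⟪L (p k - x (k - 1)), η (k + 1) - u k⟫_ℝ := by
      rw [h.inner_increment_dual_gap hLV, ← inner_add_right]
      congr 1
      abel
    have h3 := hcross k (η (k + 1) - u k)
    have h4 := hcross k (η (k + 1) - uh)
    rw [e3] at h4
    rw [hF, hF, Nat.add_sub_cancel]
    set P := ‖p (k + 1) - xh‖ ^ 2
    set Y := ‖η (k + 1) - uh‖ ^ 2
    set R := ‖p (k + 1) - x k‖ ^ 2
    set S := ‖η (k + 1) - u k‖ ^ 2
    set r := ‖p k - x (k - 1)‖ ^ 2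
    set I := ⟪L (p (k + 1) - x k), η (k + 1) - uh⟫_ℝ
    set J := ⟪L (p k - x (k - 1)), η k - uh⟫_ℝ
    set K := ⟪L (p k - x (k - 1)), η (k + 1) - u k⟫_ℝ
    have hP0 : 0 ≤ P := sq_nonneg _
    have hY0 : 0 ≤ Y := sq_nonneg _
    have hr0 : 0 ≤ r := sq_nonneg _
    have g1 := mul_le_mul_of_nonneg_left h2 hω0.le
    have g2 : c * ‖x (k + 1) - xh‖ ^ 2 ≤ ω * ((μ * ρ + c) * P) := by
      have i1 : c ≤ ω * (μ * ρ + c) := by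
        have j1 := mul_le_mul_of_nonneg_left hac hω0.le
        have j2 := mul_le_mul_of_nonneg_right hω1 hc0.le
        linarith only [j1, j2]
      calc c * ‖x (k + 1) - xh‖ ^ 2 ≤ c * P := mul_le_mul_of_nonneg_left hxp hc0.le
        _ ≤ ω * (μ * ρ + c) * P := mul_le_mul_of_nonneg_right i1 hP0
        _ = _ := by ring
    have g3 : b * ‖u (k + 1) - uh‖ ^ 2 + (θ - ω) * (χ * Y) ≤ ω * ((μ * χ + b) * Y) := by
      have i1 : b + (θ - ω) * χ ≤ ω * (μ * χ + b) := by
        have j1 := mul_le_mul_of_nonneg_left hab hω0.le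
        have j2 := mul_le_mul_of_nonneg_left hb0 hωθ
        have j3 : ω * (1 + a) * b - b = (θ - ω) * b := by rw [← hωa]; ring
        linarith only [j1, j2, j3]
      have i2 := mul_le_mul_of_nonneg_right i1 hY0
      have i3 := mul_le_mul_of_nonneg_left huη (hχ.le.trans hb0)
      linarith only [i2, i3]
    -- The cross term with weight `θ` is split: the `ω` part keeps `J` in the energy and bounds `K`
    -- by the residual `S`, while the `θ - ω` part is bounded by the surplus of `Y` from `g3`. The
    -- `r` contributions add up to `θ * ω ^ 2 * ρ * r`, covered because `θ ≤ 1`.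
    have g4 : ω * (ω * (μ * K)) ≤ ω * (ω ^ 2 * (ρ * r) + χ * S) :=
      mul_le_mul_of_nonneg_left ((mul_le_mul_of_nonneg_left
        (mul_le_mul_of_nonneg_left (le_abs_self K) hμ0.le) hω0.le).trans h3) hω0.le
    have g5 : (θ - ω) * (ω * (μ * (J + K))) ≤ (θ - ω) * (ω ^ 2 * (ρ * r) + χ * Y) :=
      mul_le_mul_of_nonneg_left ((mul_le_mul_of_nonneg_left
        (mul_le_mul_of_nonneg_left (le_abs_self (J + K)) hμ0.le) hω0.le).trans h4) hωθ
    have g6 : θ * (ω ^ 2 * (ρ * r)) ≤ ω ^ 2 * (ρ * r) :=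
      mul_le_of_le_one_left (by positivity) hθ.2
    linarith only [g1, g2, g3, g4, g5, g6]
  have hF0 : F 0 = b * ‖u 0 - uh‖ ^ 2 + c * ‖x 0 - xh‖ ^ 2 := by
    rw [hF]; simp [h.p_zero, add_comm]
  have hdecay : ∀ k, F k ≤ ω ^ k * F 0 := by
    intro k
    induction k with
    | zero => simp
    | succ k ih =>
      refine (hstep k).trans ((mul_le_mul_of_nonneg_left ih hω0.le).trans_eq ?_)
      ring
  intro k
  rw [← hb, ← hc, ← hF0]
  refine le_trans ?_ (hdecay k)
  have h3 := hcross k (u k - uh)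
  have e4 : χ * (1 - ω) + μ / (4 * δ) = b - ω * χ := by rw [hb]; ring
  have h5 : -(μ * |⟪L (p k - x (k - 1)), u k - uh⟫_ℝ|)
      ≤ μ * ⟪L (p k - x (k - 1)), u k - uh⟫_ℝ := by
    rw [← mul_neg]
    exact mul_le_mul_of_nonneg_left (neg_abs_le _) hμ0.le
  -- Young's inequality with weight `1` consumes exactly the term `ω * ρ * ‖p k - x (k - 1)‖ ^ 2` of
  -- the energy and costs `ω * χ` on the dual side, hence the coefficient `χ * (1 - ω) + μ / (4δ)`.
  have h6 : μ * |⟪L (p k - x (k - 1)), u k - uh⟫_ℝ|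
      ≤ ρ * ‖p k - x (k - 1)‖ ^ 2 + χ * ‖u k - uh‖ ^ 2 := by
    have i1 := weighted_young (ω := 1) (r := ‖p k - x (k - 1)‖) (v := ‖u k - uh‖) hρ.le hχ.le
    have i2 := mul_le_mul_of_nonneg_left (abs_inner_map_le L (p k - x (k - 1)) (u k - uh)) hμ0.le
    rw [← hμL] at i1
    linarith
  have h7 := mul_le_mul_of_nonneg_left h6 hω0.le
  have h8 := mul_le_mul_of_nonneg_left h5 hω0.le
  rw [hF, h.inner_increment_dual_gap hLV, e4]
  linarith

end IsProjectedPrimalDual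

end Linear

/-! ### Vanishing residuals and weak convergence -/

theorem tendsto_zero_of_mul_norm_sq_le {E : Type*} [NormedAddCommGroup E] {v : ℕ → E}
    {q : ℕ → ℝ} {c : ℝ} (hc : 0 < c) (h : ∀ k, c * ‖v k‖ ^ 2 ≤ q k)
    (hq : Tendsto q atTop (𝓝 0)) : Tendsto v atTop (𝓝 0) := by
  have h1 : Tendsto (fun k => ‖v k‖ ^ 2) atTop (𝓝 0) := by
    refine squeeze_zero (fun k => sq_nonneg _) (g := fun k => c⁻¹ * q k) (fun k => ?_)
      (by simpa using hq.const_mul c⁻¹)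
    rw [← div_eq_inv_mul, le_div_iff₀' hc]
    exact h k
  have h2 := h1.sqrt
  simp only [Real.sqrt_sq (norm_nonneg _), Real.sqrt_zero] at h2
  exact tendsto_zero_iff_norm_tendsto_zero.2 h2

/-- A nonnegative sequence with `f (k + 1) + q k ≤ f k`, `0 ≤ q k`, converges, and `q` vanishes
in the limit. -/
theorem tendsto_of_add_le {f q : ℕ → ℝ} (hf : ∀ k, 0 ≤ f k) (hq : ∀ k, 0 ≤ q k)
    (h : ∀ k, f (k + 1) + q k ≤ f k) :
    (∃ l, Tendsto f atTop (𝓝 l)) ∧ Tendsto q atTop (𝓝 0) := by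
  have hl := tendsto_atTop_ciInf (f := f)
    (antitone_nat_of_succ_le fun k => by linarith [h k, hq k]) ⟨0, by rintro _ ⟨k, rfl⟩; exact hf k⟩
  refine ⟨⟨_, hl⟩, squeeze_zero hq (fun k => le_sub_iff_add_le'.2 (h k)) ?_⟩
  simpa using hl.sub ((tendsto_add_atTop_iff_nat 1).2 hl)

section WeakConvergence

variable {H G : Type*} [NormedAddCommGroup H] [InnerProductSpace ℝ H] [CompleteSpace H]
  [NormedAddCommGroup G] [InnerProductSpace ℝ G] [CompleteSpace G]
  {T : H → H} {V : ClosedSubmodule ℝ G} {L : H →L[ℝ] G}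
  {A : H → Set H} {B D : G → Set G} {C : H → H}
  {x xbar p : ℕ → H} {u η d : ℕ → G}

namespace IsProjectedPrimalDual

/-- The energy `F` drops at each step by at least `Q`, which collects the squares of all residuals;
being nonnegative, `F` converges and `Q` tends to zero. -/
theorem tendsto_residuals {α δ β γ τ : ℝ} (hα : α ∈ Set.Ioo (0 : ℝ) 1)
    (hT : AveragedQuasiNonexpansive α T)
    (h : IsProjectedPrimalDual T V L A B D C (fun _ => 1) (fun _ => γ) (fun _ => τ)
      x xbar p u η)
    (hLV : ∀ z : H, L z ∈ V) (hA : StronglyMonotone 0 A) (hB : Cocoercive 0 B)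
    (hβ : 0 < β) (hC : Cocoercive β (svOfFun C)) (hδ : 0 < δ) (hD : StronglyMonotone δ D)
    (hγ : γ ∈ Set.Ioo (0 : ℝ) (2 * δ)) (hτ : τ ∈ Set.Ioo (0 : ℝ) (2 * β))
    (hLn : ‖L‖ ^ 2 < (1 / τ - 1 / (2 * β)) * (1 / γ - 1 / (2 * δ)))
    (hd : ∀ k, d k ∈ svInverse D (u k) ∧
      γ⁻¹ • (u k - η (k + 1)) + L (xbar k) - d k ∈ svInverse B (η (k + 1)))
    {xh : H} {uh dh : G} (hs : IsPrimalDualSolution T V L A B D C xh uh)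
    (hdh : dh ∈ svInverse D uh) (hbh : L xh - dh ∈ svInverse B uh) :
    (∃ l, Tendsto (fun k => ‖x k - xh‖ ^ 2 / τ + ‖u k - uh‖ ^ 2 / γ) atTop (𝓝 l)) ∧
      Tendsto (fun k => p (k + 1) - x k) atTop (𝓝 0) ∧
      Tendsto (fun k => η (k + 1) - u k) atTop (𝓝 0) ∧
      Tendsto (fun k => p (k + 1) - T (p (k + 1))) atTop (𝓝 0) ∧
      Tendsto (fun k => η (k + 1) - u (k + 1)) atTop (𝓝 0) ∧
      Tendsto (fun k => C (x k)) atTop (𝓝 (C xh)) ∧ Tendsto d atTop (𝓝 dh) := by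
  have hγ0 := hγ.1
  have hτ0 := hτ.1
  have hα0 := hα.1
  have hα1 : 0 < 1 - α := sub_pos.2 hα.2
  obtain ⟨e, he⟩ : ∃ e, e = 1 / τ - 1 / (2 * β) := ⟨_, rfl⟩
  obtain ⟨g, hg⟩ : ∃ g, g = 1 / γ - 1 / (2 * δ) := ⟨_, rfl⟩
  have he0 : 0 < e := by rw [he, sub_pos]; exact one_div_lt_one_div_of_lt hτ0 hτ.2
  have hg0 : 0 < g := by rw [hg, sub_pos]; exact one_div_lt_one_div_of_lt hγ0 hγ.2
  rw [← he, ← hg] at hLn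
  -- The strict step-size condition becomes `c < 1`, leaving the fraction `1 - c` of the squared
  -- increments in `Q`.
  obtain ⟨c, hc0, hc1, hcL⟩ : ∃ c, 0 ≤ c ∧ c < 1 ∧ ‖L‖ = c * (Real.sqrt e * Real.sqrt g) := by
    have hpos : 0 < Real.sqrt e * Real.sqrt g := by positivity
    refine ⟨‖L‖ / (Real.sqrt e * Real.sqrt g), by positivity, ?_, by field_simp⟩
    rw [div_lt_one hpos, ← Real.sqrt_mul he0.le]
    exact Real.lt_sqrt_of_sq_lt hLn
  have hcross : ∀ (y : H) (v : G), 2 * |⟪L y, v⟫_ℝ| ≤ c * e * ‖y‖ ^ 2 + c * g * ‖v‖ ^ 2 := by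
    intro y v
    have h1 := abs_inner_map_le L y v
    have h2 := mul_nonneg hc0 (sq_nonneg (Real.sqrt e * ‖y‖ - Real.sqrt g * ‖v‖))
    have h3 : c * (Real.sqrt e * ‖y‖ - Real.sqrt g * ‖v‖) ^ 2
        = c * Real.sqrt e ^ 2 * ‖y‖ ^ 2 + c * Real.sqrt g ^ 2 * ‖v‖ ^ 2
          - 2 * (c * (Real.sqrt e * Real.sqrt g) * ‖y‖ * ‖v‖) := by ring
    rw [h3, Real.sq_sqrt he0.le, Real.sq_sqrt hg0.le, ← hcL] at h2
    linarith
  -- The squares left by the cocoercive forward bounds. Once they and the increments vanish, `C (x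
  -- k)` and `d k` converge strongly.
  obtain ⟨eC, heC⟩ : ∃ eC : ℕ → H, ∀ k, eC k
    = (C (x k) - C xh) + (1 / (2 * β)) • (p (k + 1) - x k) := ⟨_, fun _ => rfl⟩
  obtain ⟨eD, heD⟩ : ∃ eD : ℕ → G, ∀ k, eD k
    = (d k - dh) + (1 / (2 * δ)) • (η (k + 1) - u k) := ⟨_, fun _ => rfl⟩
  obtain ⟨F, hF⟩ : ∃ F : ℕ → ℝ, ∀ k, F k = ‖x k - xh‖ ^ 2 / τ + ‖u k - uh‖ ^ 2 / γ
      + c * e * ‖p k - x (k - 1)‖ ^ 2 + 2 * ⟪L (p k - x (k - 1)), η k - uh⟫_ℝ :=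
    ⟨_, fun _ => rfl⟩
  obtain ⟨Q, hQ⟩ : ∃ Q : ℕ → ℝ, ∀ k, Q k = (1 - c) * e * ‖p (k + 1) - x k‖ ^ 2
      + (1 - c) * g * ‖η (k + 1) - u k‖ ^ 2
      + (1 - α) / α / τ * ‖p (k + 1) - T (p (k + 1))‖ ^ 2
      + 1 / γ * ‖η (k + 1) - u (k + 1)‖ ^ 2 + 2 * β * ‖eC k‖ ^ 2 + 2 * δ * ‖eD k‖ ^ 2 :=
    ⟨_, fun _ => rfl⟩
  have hc1' : 0 < 1 - c := sub_pos.2 hc1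
  have q1 : ∀ k, 0 ≤ (1 - c) * e * ‖p (k + 1) - x k‖ ^ 2 := fun k => by positivity
  have q2 : ∀ k, 0 ≤ (1 - c) * g * ‖η (k + 1) - u k‖ ^ 2 := fun k => by positivity
  have q3 : ∀ k, 0 ≤ (1 - α) / α / τ * ‖p (k + 1) - T (p (k + 1))‖ ^ 2 := fun k => by positivity
  have q4 : ∀ k, 0 ≤ 1 / γ * ‖η (k + 1) - u (k + 1)‖ ^ 2 := fun k => by positivity
  have q5 : ∀ k, 0 ≤ 2 * β * ‖eC k‖ ^ 2 := fun k => by positivity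
  have q6 : ∀ k, 0 ≤ 2 * δ * ‖eD k‖ ^ 2 := fun k => by positivity
  have hstep : ∀ k, F (k + 1) + Q k ≤ F k := by
    intro k
    have hCk := hC.forward_bound hβ (x k) (p (k + 1)) xh
    have hDk := hD.forward_bound hδ (u k) uh (η (k + 1)) (d k) dh (hd k).1 hdh
    have h1 := h.energy_step hLV hA hB (fun _ => hγ0) (fun _ => hτ0) hs.exists_dual.2.2.1 hbh
      (hd k).2 hCk hDk
    rw [← heC, ← heD, ← he, ← hg] at h1
    have h2 := le_abs_self ⟪L (p k - x (k - 1)), η (k + 1) - u k⟫_ℝ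
    have h3 := hcross (p k - x (k - 1)) (η (k + 1) - u k)
    have h4 : ‖x (k + 1) - xh‖ ^ 2 / τ + (1 - α) / α / τ * ‖p (k + 1) - T (p (k + 1))‖ ^ 2
        ≤ ‖p (k + 1) - xh‖ ^ 2 / τ := by
      have := div_le_div_of_nonneg_right (hT.2 (p (k + 1)) xh hs.1) hτ0.le
      rw [h.primal_proj, div_mul_eq_mul_div]
      rw [sub_div] at this
      linarith
    have h5 : ‖u (k + 1) - uh‖ ^ 2 / γ + 1 / γ * ‖η (k + 1) - u (k + 1)‖ ^ 2
        = ‖η (k + 1) - uh‖ ^ 2 / γ := by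
      rw [← h.norm_dual_sub_sq hs.2.1 k]; ring
    rw [hF, hF, hQ, Nat.add_sub_cancel]
    linarith
  -- The cross term takes at most `g` out of `1 / γ = g + 1 / (2δ)`. The rest makes `F` nonnegative
  -- and bounds `u`, so that the cross term tends to zero and `F` has the same limit as the weighted
  -- distance.
  have hlower : ∀ k, 1 / (2 * δ) * ‖u k - uh‖ ^ 2 ≤ F k := by
    intro k
    have h1 := hcross (p k - x (k - 1)) (u k - uh)
    have h2 := neg_le_abs ⟪L (p k - x (k - 1)), u k - uh⟫_ℝ
    have h3 : c * g * ‖u k - uh‖ ^ 2 ≤ g * ‖u k - uh‖ ^ 2 := by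
      rw [mul_assoc]
      exact mul_le_of_le_one_left (by positivity) hc1.le
    have h4 : ‖u k - uh‖ ^ 2 / γ = g * ‖u k - uh‖ ^ 2 + 1 / (2 * δ) * ‖u k - uh‖ ^ 2 := by
      rw [hg]; ring
    have h5 : 0 ≤ ‖x k - xh‖ ^ 2 / τ := by positivity
    rw [hF, h.inner_increment_dual_gap hLV]
    linarith
  have hF0 : ∀ k, 0 ≤ F k := fun k => le_trans (by positivity) (hlower k)
  have hQ0 : ∀ k, 0 ≤ Q k := fun k => by
    rw [hQ]; linarith [q1 k, q2 k, q3 k, q4 k, q5 k, q6 k]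
  obtain ⟨⟨l, hl⟩, hQlim⟩ := tendsto_of_add_le hF0 hQ0 hstep
  have t1 : Tendsto (fun k => p (k + 1) - x k) atTop (𝓝 0) :=
    tendsto_zero_of_mul_norm_sq_le (c := (1 - c) * e) (by positivity)
      (fun k => by rw [hQ]; linarith [q2 k, q3 k, q4 k, q5 k, q6 k]) hQlim
  have t2 : Tendsto (fun k => η (k + 1) - u k) atTop (𝓝 0) :=
    tendsto_zero_of_mul_norm_sq_le (c := (1 - c) * g) (by positivity)
      (fun k => by rw [hQ]; linarith [q1 k, q3 k, q4 k, q5 k, q6 k]) hQlim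
  have t3 : Tendsto (fun k => p (k + 1) - T (p (k + 1))) atTop (𝓝 0) :=
    tendsto_zero_of_mul_norm_sq_le (c := (1 - α) / α / τ) (by positivity)
      (fun k => by rw [hQ]; linarith [q1 k, q2 k, q4 k, q5 k, q6 k]) hQlim
  have t4 : Tendsto (fun k => η (k + 1) - u (k + 1)) atTop (𝓝 0) :=
    tendsto_zero_of_mul_norm_sq_le (c := 1 / γ) (by positivity)
      (fun k => by rw [hQ]; linarith [q1 k, q2 k, q3 k, q5 k, q6 k]) hQlim
  have t5 : Tendsto eC atTop (𝓝 0) :=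
    tendsto_zero_of_mul_norm_sq_le (c := 2 * β) (by positivity)
      (fun k => by rw [hQ]; linarith [q1 k, q2 k, q3 k, q4 k, q6 k]) hQlim
  have t6 : Tendsto eD atTop (𝓝 0) :=
    tendsto_zero_of_mul_norm_sq_le (c := 2 * δ) (by positivity)
      (fun k => by rw [hQ]; linarith [q1 k, q2 k, q3 k, q4 k, q5 k]) hQlim
  refine ⟨⟨l, ?_⟩, t1, t2, t3, t4, ?_, ?_⟩
  · have s1 : Tendsto (fun k => p k - x (k - 1)) atTop (𝓝 0) :=
      (tendsto_add_atTop_iff_nat 1).1 t1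
    have s2 : Tendsto (fun k => c * e * ‖p k - x (k - 1)‖ ^ 2) atTop (𝓝 0) := by
      simpa using (s1.norm.pow 2).const_mul (c * e)
    have hanti : ∀ k, F k ≤ F 0 := fun k => by
      induction k with
      | zero => rfl
      | succ k ih => linarith [hstep k, hQ0 k]
    have hbd : ∀ k, ‖u k - uh‖ ≤ Real.sqrt (2 * δ * F 0) := fun k => by
      refine Real.le_sqrt_of_sq_le ?_
      have := (hlower k).trans (hanti k)
      rwa [one_div_mul_eq_div, div_le_iff₀' (by positivity)] at this
    have s3 : Tendsto (fun k => L (p k - x (k - 1))) atTop (𝓝 0) := by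
      have := (L.continuous.tendsto 0).comp s1
      rwa [map_zero] at this
    have s4 : Tendsto (fun k => 2 * ⟪L (p k - x (k - 1)), η k - uh⟫_ℝ) atTop (𝓝 0) := by
      have := (Filter.Tendsto.inner_of_bounded hbd s3).const_mul 2
      rw [mul_zero] at this
      refine this.congr fun k => ?_
      rw [h.inner_increment_dual_gap hLV, real_inner_comm]
    have s5 := (hl.sub s2).sub s4
    rw [sub_zero, sub_zero] at s5
    refine s5.congr fun k => ?_
    rw [hF]; ring
  · have := (t5.sub (t1.const_smul (1 / (2 * β)))).add_const (C xh)
    rw [smul_zero, sub_zero, zero_add] at this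
    refine this.congr fun k => ?_
    rw [heC]; abel
  · have := (t6.sub (t2.const_smul (1 / (2 * δ)))).add_const dh
    rw [smul_zero, sub_zero, zero_add] at this
    refine this.congr fun k => ?_
    rw [heD]; abel

/-- Products of two weakly convergent sequences need not converge, so the inclusions for `A` and `B`
cannot be passed to the limit separately. In the sum of their monotonicity inequalities the skew
coupling through `L` cancels these products, leaving only terms to which weak or weak-strong
convergence applies. -/
theorem isPrimalDualSolution_of_weaklyConverges {β γ τ : ℝ}
    (h : IsProjectedPrimalDual T V L A B D C (fun _ => 1) (fun _ => γ) (fun _ => τ)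
      x xbar p u η)
    (hLV : ∀ z : H, L z ∈ V) (hA : MaximallyMonotone A) (hB : MaximallyMonotone B)
    (hD : MaximallyMonotone D) (hβ : 0 < β) (hC : Cocoercive β (svOfFun C))
    (hT : DemiclosedAtZero T) (hτ : 0 < τ)
    (hd : ∀ k, d k ∈ svInverse D (u k) ∧
      γ⁻¹ • (u k - η (k + 1)) + L (xbar k) - d k ∈ svInverse B (η (k + 1)))
    (t1 : Tendsto (fun k => p (k + 1) - x k) atTop (𝓝 0))
    (t2 : Tendsto (fun k => η (k + 1) - u k) atTop (𝓝 0))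
    (t3 : Tendsto (fun k => p (k + 1) - T (p (k + 1))) atTop (𝓝 0))
    (t4 : Tendsto (fun k => η (k + 1) - u (k + 1)) atTop (𝓝 0))
    {c : H} {dh : G} (t5 : Tendsto (fun k => C (x k)) atTop (𝓝 c))
    (t6 : Tendsto d atTop (𝓝 dh)) {φ : ℕ → ℕ} (hφ : Tendsto φ atTop atTop) {w : H} {w' : G}
    (hx : WeaklyConverges (x ∘ φ) w) (hu : WeaklyConverges (u ∘ φ) w') :
    IsPrimalDualSolution T V L A B D C w w' := by
  have hp : WeaklyConverges (fun n => p (φ n + 1)) w := hx.of_sub_tendsto_zero (t1.comp hφ)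
  have hη : WeaklyConverges (fun n => η (φ n + 1)) w' := hu.of_sub_tendsto_zero (t2.comp hφ)
  have hu' : WeaklyConverges (fun n => u (φ n + 1)) w' := by
    refine hη.of_sub_tendsto_zero ?_
    simpa using (t4.comp hφ).neg
  have hwT : w ∈ Function.fixedPoints T := hT _ w hp (t3.comp hφ)
  have hwV : w' ∈ V := by
    -- `V` is weakly closed: test the weak limit against its own component orthogonal to `V`.
    have h0 : ∀ n, ⟪w' - V.toSubmodule.starProjection w', u (φ n + 1)⟫_ℝ = 0 := fun n => by
      rw [real_inner_comm]
      refine inner_starProjection_sub_eq_zero ?_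
      rw [h.dual_proj]
      exact Submodule.starProjection_apply_mem _ _
    have h1 := weaklyConverges_iff.1 hu' (w' - V.toSubmodule.starProjection w')
    simp_rw [h0] at h1
    have h2 := tendsto_nhds_unique h1 tendsto_const_nhds
    have h3 : ⟪w' - V.toSubmodule.starProjection w', V.toSubmodule.starProjection w'⟫_ℝ = 0 := by
      rw [real_inner_comm]
      exact inner_starProjection_sub_eq_zero (Submodule.starProjection_apply_mem _ _)
    have h4 : w' - V.toSubmodule.starProjection w' = 0 := by
      rw [← inner_self_eq_zero (𝕜 := ℝ), inner_sub_right, h2, h3, sub_zero]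
    rw [sub_eq_zero.1 h4]
    exact Submodule.starProjection_apply_mem _ _
  -- Cocoercivity, passed to the limit with weak convergence of `x` and strong convergence of `C (x
  -- k)`, gives `β * ‖c - C w‖ ^ 2 ≤ 0`.
  have hCw : C w = c := by
    have h1 : Tendsto (fun n => β * ‖C (x (φ n)) - C w‖ ^ 2) atTop (𝓝 (β * ‖c - C w‖ ^ 2)) :=
      (((t5.comp hφ).sub_const (C w)).norm.pow 2).const_mul β
    have h2 := (hx.sub_const w).inner ((t5.comp hφ).sub_const (C w))
    have h3 : β * ‖c - C w‖ ^ 2 ≤ ⟪w - w, c - C w⟫_ℝ := by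
      refine le_of_tendsto_of_tendsto' h1 h2 fun n => ?_
      rw [real_inner_comm]
      exact hC.map_le _ _
    rw [sub_self, inner_zero_left] at h3
    have h4 : ‖c - C w‖ ^ 2 = 0 :=
      le_antisymm (nonpos_of_mul_nonpos_right h3 hβ) (sq_nonneg _)
    rw [pow_eq_zero_iff two_ne_zero, norm_eq_zero, sub_eq_zero] at h4
    exact h4.symm
  have hDw : w' ∈ D dh := hD.mem_of_forall fun y v hv => by
    rw [real_inner_comm]
    refine ge_of_tendsto' ((hu.sub_const v).inner ((t6.comp hφ).sub_const y)) fun n => ?_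
    have := hD.1 (d (φ n)) (u (φ n)) y v (hd (φ n)).1 hv
    rw [zero_mul, real_inner_comm] at this
    exact this
  -- `r` and `s` are the strongly convergent parts: the elements of `A` at `p (k + 1)` and of `B⁻¹`
  -- at `η (k + 1)` are `r k - L* u (k + 1)` and `s k + L p (k + 1)`.
  obtain ⟨r, hr⟩ : ∃ r : ℕ → H, ∀ k, r k = τ⁻¹ • (x k - p (k + 1)) - C (x k) :=
    ⟨_, fun _ => rfl⟩
  obtain ⟨s, hs⟩ : ∃ s : ℕ → G, ∀ k, s k
      = γ⁻¹ • (u k - η (k + 1)) + L (xbar k - p (k + 1)) - d k := ⟨_, fun _ => rfl⟩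
  have hrlim : Tendsto r atTop (𝓝 (-c)) := by
    have := (t1.neg.const_smul τ⁻¹).sub t5
    rw [neg_zero, smul_zero, zero_sub] at this
    refine this.congr fun k => ?_
    rw [hr, neg_sub]
  have hslim : Tendsto s atTop (𝓝 (-dh)) := by
    have t1' : Tendsto (fun k => p k - x (k - 1)) atTop (𝓝 0) :=
      (tendsto_add_atTop_iff_nat 1).1 t1
    have h1 : Tendsto (fun k => L (xbar k - p (k + 1))) atTop (𝓝 0) := by
      have h2 := t1'.sub t1
      rw [sub_zero] at h2
      have h3 := (L.continuous.tendsto 0).comp h2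
      rw [map_zero] at h3
      refine h3.congr fun k => ?_
      rw [h.xbar_eq k, one_smul, Function.comp_apply]
      congr 1
      abel
    have := ((t2.neg.const_smul γ⁻¹).add h1).sub t6
    rw [neg_zero, smul_zero, zero_add, zero_sub] at this
    refine this.congr fun k => ?_
    rw [hs, neg_sub]
  have key := hA.mem_prod_of_forall hB (x := w) (a := -(ContinuousLinearMap.adjoint L w') + -c)
    (u := w') (b := L w + -dh) fun y a v b ha hv => by
    have l1 := (hp.sub_const y).inner ((hrlim.comp hφ).sub_const a)
    have l2 := (hη.sub_const v).inner ((hslim.comp hφ).sub_const b)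
    have l3 := weaklyConverges_iff.1 hu' (L y)
    have l4 := weaklyConverges_iff.1 hp (ContinuousLinearMap.adjoint L v)
    have l5 := ((l1.add l2).add l3).sub l4
    have e : ⟪w - y, -(ContinuousLinearMap.adjoint L w') + -c - a⟫_ℝ
        + ⟪w' - v, L w + -dh - b⟫_ℝ
        = ⟪w - y, -c - a⟫_ℝ + ⟪w' - v, -dh - b⟫_ℝ + ⟪L y, w'⟫_ℝ
          - ⟪ContinuousLinearMap.adjoint L v, w⟫_ℝ := by
      rw [add_sub_assoc, inner_add_right, add_sub_assoc, inner_add_right, inner_neg_right,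
        inner_sub_left w y, inner_sub_left w' v, ContinuousLinearMap.adjoint_inner_right,
        ContinuousLinearMap.adjoint_inner_right, ContinuousLinearMap.adjoint_inner_left,
        real_inner_comm (L w) w']
      ring
    rw [e]
    refine ge_of_tendsto' l5 fun n => ?_
    have m1 := hA.1 _ _ _ _ (h.primal_mem (fun _ => hτ) (φ n)) ha
    have m2 := hB.1 _ _ _ _ (hd (φ n)).2 hv
    have f1 : τ⁻¹ • (x (φ n) - p (φ n + 1)) + -(ContinuousLinearMap.adjoint L (u (φ n + 1)))
        - C (x (φ n)) - a = -(ContinuousLinearMap.adjoint L (u (φ n + 1))) + (r (φ n) - a) := by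
      rw [hr]; abel
    have f2 : γ⁻¹ • (u (φ n) - η (φ n + 1)) + L (xbar (φ n)) - d (φ n) - b
        = L (p (φ n + 1)) + (s (φ n) - b) := by
      rw [hs, map_sub]; abel
    -- This makes the weak-weak products in `m1` and `m2` opposite to each other.
    have f3 : ⟪L (p (φ n + 1)), η (φ n + 1)⟫_ℝ = ⟪L (p (φ n + 1)), u (φ n + 1)⟫_ℝ := by
      have := h.inner_dual_gap hLV (p (φ n + 1)) (φ n)
      rwa [inner_sub_right, sub_eq_zero] at this
    rw [zero_mul, f1, inner_add_right, inner_neg_right, ContinuousLinearMap.adjoint_inner_right,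
      map_sub, inner_sub_left] at m1
    rw [zero_mul, real_inner_comm, f2, inner_add_right, inner_sub_left _ v, real_inner_comm,
      f3] at m2
    simp only [Function.comp_apply]
    rw [ContinuousLinearMap.adjoint_inner_left]
    linarith
  refine ⟨hwT, hwV, ⟨_, key.1, C w, rfl, ?_⟩, _, key.2, dh, hDw, ?_⟩
  · rw [hCw]
    exact neg_add_cancel_right _ _
  · exact neg_add_cancel_right _ _

theorem exists_weaklyConverges {α δ β γ τ : ℝ} (hα : α ∈ Set.Ioo (0 : ℝ) 1)
    (hT : AveragedQuasiNonexpansive α T) (hT' : DemiclosedAtZero T)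
    (h : IsProjectedPrimalDual T V L A B D C (fun _ => 1) (fun _ => γ) (fun _ => τ)
      x xbar p u η)
    (hLV : ∀ z : H, L z ∈ V) (hA : MaximallyMonotone A) (hB : MaximallyMonotone B)
    (hBχ : Cocoercive 0 B) (hβ : 0 < β) (hC : Cocoercive β (svOfFun C)) (hδ : 0 < δ)
    (hD : MaximallyMonotone D) (hDδ : StronglyMonotone δ D)
    (hγ : γ ∈ Set.Ioo (0 : ℝ) (2 * δ)) (hτ : τ ∈ Set.Ioo (0 : ℝ) (2 * β))
    (hLn : ‖L‖ ^ 2 < (1 / τ - 1 / (2 * β)) * (1 / γ - 1 / (2 * δ)))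
    (hsol : ∃ xh uh, IsPrimalDualSolution T V L A B D C xh uh) :
    ∃ xh uh, IsPrimalDualSolution T V L A B D C xh uh ∧
      WeaklyConverges x xh ∧ WeaklyConverges u uh := by
  obtain ⟨d, hd⟩ := h.exists_dual fun _ => hγ.1
  refine opial_pair hτ.1 hγ.1 hsol (fun xh uh hs => ?_) fun φ w w' hφ hx hu => ?_
  · obtain ⟨-, -, -, dh, hdh, hbh⟩ := hs.exists_dual
    exact (h.tendsto_residuals hα hT hLV hA.1 hBχ hβ hC hδ hDδ hγ hτ hLn hd hs hdh hbh).1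
  -- Any fixed solution serves here: it supplies the strong limits of `C (x k)` and `d k` used to
  -- identify every cluster point.
  · obtain ⟨xh, uh, hs⟩ := hsol
    obtain ⟨-, -, -, dh, hdh, hbh⟩ := hs.exists_dual
    obtain ⟨-, t1, t2, t3, t4, t5, t6⟩ :=
      h.tendsto_residuals hα hT hLV hA.1 hBχ hβ hC hδ hDδ hγ hτ hLn hd hs hdh hbh
    exact h.isPrimalDualSolution_of_weaklyConverges hLV hA hB hD hβ hC hT' hτ.1 hd
      t1 t2 t3 t4 t5 t6 hφ hx hu

end IsProjectedPrimalDual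

end WeakConvergence

/-! ### The four assertions together -/

theorem theorem1 {H G : Type*}
    [NormedAddCommGroup H] [InnerProductSpace ℝ H] [CompleteSpace H]
    [NormedAddCommGroup G] [InnerProductSpace ℝ G] [CompleteSpace G]
    (T : H → H) (α : ℝ) (hα : α ∈ Set.Ioo (0 : ℝ) 1) (hT : AveragedQuasiNonexpansive α T)
    (V : ClosedSubmodule ℝ G)
    (L : H →L[ℝ] G) (hL : L ≠ 0) (hLV : ∀ z : H, L z ∈ V)
    (A : H → Set H) (B D : G → Set G) (C : H → H)
    (ρ χ δ β : ℝ) (hρ : 0 ≤ ρ) (hχ : 0 ≤ χ) (hδ : 0 < δ) (hβ : 0 < β)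
    (hA : MaximallyMonotone A) (hAρ : StronglyMonotone ρ A)
    (hD : MaximallyMonotone D) (hDδ : StronglyMonotone δ D)
    (hB : MaximallyMonotone B) (hBχ : Cocoercive χ B)
    (hC : Cocoercive β (svOfFun C))
    (hsol : ∃ xh uh, IsPrimalDualSolution T V L A B D C xh uh) :
    -- (i) one-step energy inequality
    (∀ (θ γ τ : ℕ → ℝ) (x xbar p : ℕ → H) (u η : ℕ → G),
      (∀ k, θ k ∈ Set.Ioc (0 : ℝ) 1) →
      (∀ k, γ k ∈ Set.Ioo (0 : ℝ) (2 * δ)) →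
      (∀ k, τ k ∈ Set.Ioo (0 : ℝ) (2 * β)) →
      ‖L‖ ^ 2 ≤ (1 / τ 0 - 1 / (2 * β)) * (1 / γ 0 - 1 / (2 * δ)) →
      IsProjectedPrimalDual T V L A B D C θ γ τ x xbar p u η →
      ∀ xh uh, IsPrimalDualSolution T V L A B D C xh uh →
      -- at `k = 0` the difference `p k - x (k - 1)` is `p 0 - x 0 = 0`
      ∀ k : ℕ,
        ‖x k - xh‖ ^ 2 / τ k + ‖u k - uh‖ ^ 2 / γ k ≥
          (2 * ρ * τ k + 1) * (‖p (k + 1) - xh‖ ^ 2 / τ k)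
          + ‖p (k + 1) - x k‖ ^ 2 * (1 / τ k - 1 / (2 * β))
          + (2 * χ * γ k + 1) * (‖η (k + 1) - uh‖ ^ 2 / γ k)
          + ‖η (k + 1) - u k‖ ^ 2 * (1 / γ k - 1 / (2 * δ))
          + 2 * ⟪L (p (k + 1) - x k), η (k + 1) - uh⟫_ℝ
          - 2 * θ (k - 1) * ⟪L (p k - x (k - 1)), η k - uh⟫_ℝ
          - 2 * θ (k - 1) * ‖L‖ * ‖p k - x (k - 1)‖ * ‖η (k + 1) - u k‖) ∧
    -- (ii) weak convergence
    (ρ = 0 → χ = 0 → DemiclosedAtZero T →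
      ∀ (γ τ : ℝ) (x xbar p : ℕ → H) (u η : ℕ → G),
      γ ∈ Set.Ioo (0 : ℝ) (2 * δ) →
      τ ∈ Set.Ioo (0 : ℝ) (2 * β) →
      ‖L‖ ^ 2 < (1 / τ - 1 / (2 * β)) * (1 / γ - 1 / (2 * δ)) →
      IsProjectedPrimalDual T V L A B D C (fun _ => 1) (fun _ => γ) (fun _ => τ)
        x xbar p u η →
      ∃ xh uh, IsPrimalDualSolution T V L A B D C xh uh ∧
        WeaklyConverges x xh ∧ WeaklyConverges u uh) ∧
    -- (iii) accelerated rate; `D⁻¹ = 0` corresponds to `δ = ∞`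
    (0 < ρ → χ = 0 → (∀ v, svInverse D v = {0}) →
      ∀ (θ γ τ : ℕ → ℝ) (x xbar p : ℕ → H) (u η : ℕ → G),
      0 < γ 0 →
      τ 0 ∈ Set.Ioo (0 : ℝ) (2 * β) →
      ‖L‖ ^ 2 = (1 / τ 0 - 1 / (2 * β)) * (1 / γ 0) →
      (∀ k, θ k = 1 / Real.sqrt (1 + 2 * ρ * τ k)) →
      (∀ k, τ (k + 1) = θ k * τ k) →
      (∀ k, γ (k + 1) = γ k / θ k) →
      IsProjectedPrimalDual T V L A B D C θ γ τ x xbar p u η →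
      ∀ xh uh, IsPrimalDualSolution T V L A B D C xh uh →
      ∀ ε : ℝ, 0 < ε → ∃ N₀ : ℕ, 1 ≤ N₀ ∧ ∀ k : ℕ, N₀ ≤ k →
        ‖x k - xh‖ ^ 2 ≤ (1 + ε) / (k : ℝ) ^ 2 *
          (‖x 0 - xh‖ ^ 2 / (ρ ^ 2 * τ 0 ^ 2)
            + 2 * β * ‖L‖ ^ 2 / (ρ ^ 2 * (2 * β - τ 0)) * ‖u 0 - uh‖ ^ 2)) ∧
    -- (iv) linear convergence
    (0 < ρ → 0 < χ →
      ∀ (μ a θ γ τ ω : ℝ) (x xbar p : ℕ → H) (u η : ℕ → G),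
      μ = 2 * Real.sqrt (ρ * χ) / ‖L‖ →
      a = min (μ * ρ / (ρ + μ / (4 * β))) (μ * χ / (χ + μ / (4 * δ))) →
      θ ∈ Set.Ioc ((1 + a)⁻¹) 1 →
      τ = 2 * β * μ / (μ + 4 * β * ρ) →
      γ = 2 * μ * δ / (μ + 4 * δ * χ) →
      ω = (1 + θ) / (2 + a) →
      IsProjectedPrimalDual T V L A B D C (fun _ => θ) (fun _ => γ) (fun _ => τ)
        x xbar p u η →
      ω ∈ Set.Ico ((1 + a)⁻¹) θ ∧
      ∀ xh uh, IsPrimalDualSolution T V L A B D C xh uh →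
      ∀ k : ℕ,
        (χ * (1 - ω) + μ / (4 * δ)) * ‖u k - uh‖ ^ 2
            + (ρ + μ / (4 * β)) * ‖x k - xh‖ ^ 2 ≤
          ω ^ k * ((χ + μ / (4 * δ)) * ‖u 0 - uh‖ ^ 2
            + (ρ + μ / (4 * β)) * ‖x 0 - xh‖ ^ 2)) := by
  refine ⟨?_, ?_, ?_, ?_⟩
  · intro θ γ τ x xbar p u η hθ hγ hτ _ h xh uh hs k
    exact h.energy_le_norm hLV hAρ hBχ hβ hC hδ hDδ (fun k => (hθ k).1.le) (fun k => (hγ k).1)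
      (fun k => (hτ k).1) hs k
  · rintro rfl rfl hT' γ τ x xbar p u η hγ hτ hLn h
    exact h.exists_weaklyConverges hα hT hT' hLV hA hB hBχ hβ hC hδ hD hDδ hγ hτ hLn hsol
  · rintro hρ rfl hD0 θ γ τ x xbar p u η hγ0 hτ0 hLn hθ hτ hγ h xh uh hs ε hε
    exact h.accelerated_rate hα hT hLV hAρ hρ hBχ hβ hC hD0 hγ0 hτ0 hLn hθ hτ hγ hs hε
  · intro hρ hχ μ a θ γ τ ω x xbar p u η hμ ha hθ hτ hγ hω h
    exact h.linear_rate hα hT hL hLV hAρ hρ hχ hBχ hβ hC hδ hDδ hμ ha hθ hτ hγ hω
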